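/- **Setting.** Let $M$ be a sphere of dimension $d\ge 1$ (a smooth manifold homeomorphic to $S^d$) with a smooth Riemannian metric and its Riemannian distance, and let $f:M\to M$ be a $C^1$ diffeomorphism with north-south dynamics: there are distinct fixed points $N,S$ such that $f^n(p)\to S$ and $f^{-n}(p)\to N$ as $n\to+\infty$ for every $p\in M\setminus\{N,S\}$. Let $r>0$ and $\mu\in(0,1)$ be such that, for all $n\ge 0$, $d(f^n(p),f^n(q))\le\mu^n d(p,q)$ if $p,q\in B_r(S)$, and $d(f^{-n}(p),f^{-n}(q))\le\mu^n d(p,q)$ if $p,q\in B_r(N)$, and such that $B_r(N)$ and $B_r(S)$ have disjoint closures. Let $L$ be a Lipschitz constant of $f$ and of $f^{-1}$, let $\varphi:M\to\{t\in\mathbb R:0\le t\le 1\}$ be continuous with $\varphi=1$ on $B_r(N)$ and $\varphi=0$ on $B_r(S)$, and let $\rho>0$ be such that, for every $p$, $\exp_p$ is injective on $\{v\in T_pM:\|v\|\le\rho\}$. For $d(p,q)\le\rho$ put $$[p,q]=\exp_p\big(\varphi(p)\exp_p^{-1}(q)\big),$$ the point with parameter $\varphi(p)$ on the geodesic segment (parametrized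 on $0\le t\le1$) from $p$ to $q$ of length at most $\rho$. Call $(\delta_0,u)$, with $0<\delta_0<\min\{r,\rho\}$ and $u\ge 1$ an integer, *admissible* if, with $U=\{p: d(p,N)>r-\delta_0,\ d(p,S)>r-\delta_0\}$, for all $p,q\in U$ with $d(p,q)<\delta_0$: the geodesic segment from $p$ to $q$ (of length at most $\rho$) is disjoint from $B_{r/2}(N)\cup B_{r/2}(S)$, and $f^i(p),f^i(q),f^i([p,q])\in B_{r/2}(N)\cup B_{r/2}(S)$ whenever $|i|\ge u$. **Definitions.** For $\delta>0$ let $\tilde M(f,\delta)$ be the set of $x\in M^{\mathbb Z}$ (product topology) with $d(x_{i+1},f(x_i))\le\delta$ for all $i$, let $(\sigma(x))_i=x_{i+1}$, and let $\mathrm{orb}_f(p)=(f^i(p))_{i\in\mathbb Z}$. A map $\mathrm{Sh}:\tilde M(f,\delta)\to M$ is * a *pseudo-orbit map* if it is continuous and $\mathrm{Sh}(\mathrm{orb}_f(p))=p$ for all $p\in M$; * a *shadowing map* if it is a pseudo-orbit map and for every $\varepsilon>0$ there is $\eta\in(0,\delta]$ such that $d(f^i(\mathrm{Sh}(x)),\mathrm{Sh}(\sigma^i(x)))\le\varepsilon$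 for all $x\in\tilde M(f,\eta)$ and $i\in\mathbb Z$; * *self-tuning*, for a weight $\lambda\in(0,1)$, if for every $\varepsilon>0$ there is $\eta>0$ such that for all $x\in\tilde M(f,\delta)$ and $i\in\mathbb Z$, $\sum_{j\in\mathbb Z}\lambda^{|j|}d(x_{i+j},f^j(x_i))<\eta$ implies $d(f^i(\mathrm{Sh}(x)),\mathrm{Sh}(\sigma^i(x)))\le\varepsilon$; * *shift-invariant* if there is $\delta'\in(0,\delta]$ with $\mathrm{Sh}(\sigma(x))=f(\mathrm{Sh}(x))$ for all $x\in\tilde M(f,\delta')$. Let $\Delta_\gamma=\{(p,q):d(p,q)\le\gamma\}$. The bracket is *$(c,\mu)$-hyperbolic on $\Delta_\gamma$*, where $\gamma>0$ and $c\ge1$, if it is continuous on $\Delta_\gamma$, $[p,p]=p$ for all $p$, and for all $(p,q)\in\Delta_\gamma$ and $n\ge0$, $d(f^n([p,q]),f^n(q))\le c\mu^nd(p,q)$ and $d(f^{-n}([p,q]),f^{-n}(p))\le c\mu^nd(p,q)$. For an integer $m\ge 0$ and $x\in\tilde M(f,\delta)$ put $q_0^\pm=x_0$ and, for $n\ge 1$,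 $$q_n^+=[f^m(q_{n-1}^+),x_{nm}],\qquad q_n^-=[x_{-nm},f^{-m}(q_{n-1}^-)],$$ $$\mathrm{Sh}_f^+(x)=\lim_{n\to\infty} f^{-nm}(q_n^+),\qquad \mathrm{Sh}_f^-(x)=\lim_{n\to\infty} f^{nm}(q_n^-),\qquad \mathrm{Sh}_f(x)=[\mathrm{Sh}_f^-(x),\mathrm{Sh}_f^+(x)].$$ Say that *the construction applies* on $\tilde M(f,\delta)$ if, for every $x\in\tilde M(f,\delta)$, the pairs of points whose brackets are taken here all belong to $\Delta_\gamma$. **Proposition.** Admissible pairs $(\delta_0,u)$ exist. Let $(\delta_0,u)$ be any admissible pair, let $0<\gamma<\delta_0$ and $c=L^u/\mu^u$. Then the bracket is $(c,\mu)$-hyperbolic on $\Delta_\gamma$. Moreover, for every integer $m\ge 0$ with $c\mu^m\le\frac1{2c}$: 1. the construction applies on $\tilde M(f,\delta)$ for every $\delta>0$ with $4L(1+L+\dots+L^{m-1})\delta\le\gamma$; 2. for every $\delta>0$ such that the construction applies on $\tilde M(f,\delta)$, the limits $\mathrm{Sh}^\pm_f(x)$ exist for all $x\in\tilde M(f,\delta)$,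 and $\mathrm{Sh}_f:\tilde M(f,\delta)\to M$ is a shadowing map which is self-tuning (for every weight $\lambda\in(0,1)$) but is not shift-invariant. -/

import Mathlib

open scoped Manifold ContDiff Topology NNReal Bundle

namespace NorthSouthShadowing

/-! ### Pseudo-orbits and pseudo-orbit maps -/

section PseudoOrbits

variable {M : Type*} [MetricSpace M]

/-- The set `M̃(f, δ)` of (two-sided) `δ`-orbits of `f`. -/
def pseudoOrbits (f : M ≃ₜ M) (δ : ℝ) : Set (ℤ → M) :=
  {x | ∀ i : ℤ, dist (x (i + 1)) (f (x i)) ≤ δ}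

/-- The `i`-th power `σ ^ i` of the shift homeomorphism, `(σ ^ i (x))_j = x_{j + i}`. -/
def shiftPow (i : ℤ) (x : ℤ → M) : ℤ → M := fun j => x (j + i)

/-- The orbit map `p ↦ (f ^ i (p))_i`. -/
def orbitMap (f : M ≃ₜ M) (p : M) : ℤ → M := fun i => (f ^ i) p

/-- The distance `∑ i, lam ^ |i| * d(x_i, y_i)` on sequences. -/
noncomputable def seqDist (lam : ℝ) (x y : ℤ → M) : ℝ :=
  ∑' i : ℤ, lam ^ i.natAbs * dist (x i) (y i)

/-- `Po` (restricted to `M̃(f, δ)`, which carries the product topology) is a pseudo-orbit map: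
it is continuous and sends the orbit of `p` to `p`. -/
structure IsPseudoOrbitMap (f : M ≃ₜ M) (δ : ℝ) (Po : (ℤ → M) → M) : Prop where
  continuousOn : ContinuousOn Po (pseudoOrbits f δ)
  orbit : ∀ p : M, Po (orbitMap f p) = p

/-- A shadowing map: a pseudo-orbit map which is almost shift-invariant on pseudo-orbits with
small jumps. -/
structure IsShadowingMap (f : M ≃ₜ M) (δ : ℝ) (Sh : (ℤ → M) → M) : Prop where
  isPseudoOrbitMap : IsPseudoOrbitMap f δ Sh
  shadowing : ∀ ε : ℝ, 0 < ε → ∃ η : ℝ, 0 < η ∧ η ≤ δ ∧ ∀ x ∈ pseudoOrbits f η, ∀ i : ℤ,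
    dist ((f ^ i) (Sh x)) (Sh (shiftPow i x)) ≤ ε

/-- Self-tuning of a map on `M̃(f, δ)`, with respect to the distance with weights `lam ^ |i|`. -/
def HasSelfTuning (lam : ℝ) (f : M ≃ₜ M) (δ : ℝ) (Sh : (ℤ → M) → M) : Prop :=
  ∀ ε : ℝ, 0 < ε → ∃ η : ℝ, 0 < η ∧ ∀ x ∈ pseudoOrbits f δ, ∀ i : ℤ,
    seqDist lam (shiftPow i x) (orbitMap f (x i)) < η →
      dist ((f ^ i) (Sh x)) (Sh (shiftPow i x)) ≤ ε

/-- Shift-invariance of a map on `M̃(f, δ)`: for some positive `δ' ≤ δ`, `Sh ∘ σ = f ∘ Sh` on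
`M̃(f, δ')`. -/
def IsShiftInvariant (f : M ≃ₜ M) (δ : ℝ) (Sh : (ℤ → M) → M) : Prop :=
  ∃ δ' : ℝ, 0 < δ' ∧ δ' ≤ δ ∧ ∀ x ∈ pseudoOrbits f δ', Sh (shiftPow 1 x) = f (Sh x)

end PseudoOrbits

/-! ### Hyperbolic brackets and the map they induce -/

section Brackets

variable {M : Type*} [MetricSpace M]

/-- `B`, restricted to `Δ_γ = {(p, q) | d(p, q) ≤ γ}`, is a bracket (continuous with `[p, p] = p`)
with `(c, μ)`-hyperbolic contraction. The values of `B` outside `Δ_γ` play no role. -/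
structure IsHyperbolicBracket (f : M ≃ₜ M) (B : M → M → M) (γ c μ : ℝ) : Prop where
  gamma_pos : 0 < γ
  one_le_c : 1 ≤ c
  mu_pos : 0 < μ
  mu_lt_one : μ < 1
  continuousOn : ContinuousOn (fun z : M × M => B z.1 z.2) {z | dist z.1 z.2 ≤ γ}
  diag : ∀ p : M, B p p = p
  forward : ∀ p q : M, dist p q ≤ γ → ∀ n : ℕ,
    dist ((f ^ n) (B p q)) ((f ^ n) q) ≤ c * μ ^ n * dist p q
  backward : ∀ p q : M, dist p q ≤ γ → ∀ n : ℕ,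
    dist ((f⁻¹ ^ n) (B p q)) ((f⁻¹ ^ n) p) ≤ c * μ ^ n * dist p q

/-- The sequence `q_0 = x_0`, `q_{n+1} = [f^m (q_n), x_{(n+1)m}]`. -/
def qSeq (f : M ≃ₜ M) (B : M → M → M) (m : ℕ) (x : ℤ → M) : ℕ → M
  | 0 => x 0
  | n + 1 => B ((f ^ m) (qSeq f B m x n)) (x (((n + 1) * m : ℕ) : ℤ))

/-- The sequence `p_n = f^{-nm} (q_n)`. -/
def pSeq (f : M ≃ₜ M) (B : M → M → M) (m : ℕ) (x : ℤ → M) (n : ℕ) : M :=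
  (f⁻¹ ^ (n * m)) (qSeq f B m x n)

/-- `Sh_f^+ (x) = lim p_n`. -/
noncomputable def shPlus (f : M ≃ₜ M) (B : M → M → M) (m : ℕ) (x : ℤ → M) : M :=
  @Filter.limUnder M _ ℕ ⟨x 0⟩ Filter.atTop (pSeq f B m x)

/-- The bracket of `f⁻¹` associated with a bracket of `f`: when `f` is replaced by `f⁻¹`, stable and
unstable directions, hence the two arguments, are exchanged. -/
def flipBracket (B : M → M → M) : M → M → M := fun p q => B q p

/-- The time reversal `x̂_i = x_{-i}`, a pseudo-orbit of `f⁻¹` when `x` is one of `f`. -/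
def reverseSeq (x : ℤ → M) : ℤ → M := fun i => x (-i)

/-- `Sh_f^- `: the map `Sh^+` of the inverse homeomorphism. -/
noncomputable def shMinus (f : M ≃ₜ M) (B : M → M → M) (m : ℕ) (x : ℤ → M) : M :=
  shPlus f⁻¹ (flipBracket B) m (reverseSeq x)

/-- The map `Sh_f = [Sh_f^-, Sh_f^+]` induced by a bracket. -/
noncomputable def inducedMap (f : M ≃ₜ M) (B : M → M → M) (m : ℕ) (x : ℤ → M) : M :=
  B (shMinus f B m x) (shPlus f B m x)

/-- All brackets occurring in the construction of the sequence `q_n` are taken in `Δ_γ`. -/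
def BracketsApply (f : M ≃ₜ M) (B : M → M → M) (γ : ℝ) (m : ℕ) (x : ℤ → M) : Prop :=
  ∀ n : ℕ, dist ((f ^ m) (qSeq f B m x n)) (x (((n + 1) * m : ℕ) : ℤ)) ≤ γ

/-- The construction of `Sh_f` makes sense on `M̃(f, δ)`: all the brackets which occur in it,
in the forward and backward sequences and in the final step, are taken in `Δ_γ`. -/
def ConstructionApplies (f : M ≃ₜ M) (B : M → M → M) (γ : ℝ) (m : ℕ) (δ : ℝ) : Prop :=
  ∀ x ∈ pseudoOrbits f δ,
    BracketsApply f B γ m x ∧ BracketsApply f⁻¹ (flipBracket B) γ m (reverseSeq x) ∧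
      dist (shMinus f B m x) (shPlus f B m x) ≤ γ

end Brackets

/-! ### Geodesics and the geodesic bracket with a cutoff -/

section Geodesics

variable {M : Type*} [MetricSpace M]

/-- `g`, restricted to `[0, 1]`, is a geodesic of constant speed `ℓ`, i.e. it is locally
length-minimizing: locally `d(g(s), g(s')) = ℓ |s - s'|`. On a complete Riemannian manifold these are
exactly the curves `t ↦ exp_p (t v)`, `0 ≤ t ≤ 1`, with `‖v‖ = ℓ`; they have length `ℓ`. -/
def IsGeodesic (ℓ : ℝ) (g : ℝ → M) : Prop :=
  0 ≤ ℓ ∧ ∀ t ∈ Set.Icc (0 : ℝ) 1, ∃ ε : ℝ, 0 < ε ∧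
    ∀ s ∈ Set.Icc (0 : ℝ) 1, ∀ s' ∈ Set.Icc (0 : ℝ) 1, |s - t| < ε → |s' - t| < ε →
      dist (g s) (g s') = ℓ * |s - s'|

/-- `g` is a geodesic segment `t ↦ exp_p (t v)` with `‖v‖ ≤ ρ` and `exp_p v = q`. -/
def IsShortGeodesic (ρ : ℝ) (p q : M) (g : ℝ → M) : Prop :=
  (∃ ℓ : ℝ, ℓ ≤ ρ ∧ IsGeodesic ℓ g) ∧ g 0 = p ∧ g 1 = q

variable (M) in
/-- For every `p`, the exponential map `exp_p` is injective on `{v | ‖v‖ ≤ ρ}`: geodesic segments of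
length at most `ρ` with the same endpoints coincide. -/
def ExpInjective (ρ : ℝ) : Prop :=
  ∀ (p q : M) (g h : ℝ → M), IsShortGeodesic ρ p q g → IsShortGeodesic ρ p q h →
    ∀ t ∈ Set.Icc (0 : ℝ) 1, g t = h t

open Classical in
/-- The bracket `[p, q] = exp_p (φ(p) exp_p⁻¹ (q))`: the point with parameter `φ(p)` on the geodesic
segment from `p` to `q` of length at most `ρ` (and `p` if there is no such segment, which does not
happen for `d(p, q) ≤ ρ` on a compact connected Riemannian manifold). -/
noncomputable def geodesicBracket (ρ : ℝ) (φ : C(M, Set.Icc (0 : ℝ) 1)) (p q : M) : M :=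
  if h : ∃ g : ℝ → M, IsShortGeodesic ρ p q g then h.choose (φ p : ℝ) else p

end Geodesics

/-! ### North-south dynamics -/

section NorthSouth

variable {M : Type*} [MetricSpace M]

/-- `f` is a north-south homeomorphism with repelling fixed point `N` and attracting fixed point
`S`. -/
structure IsNorthSouth (f : M ≃ₜ M) (N S : M) : Prop where
  ne : N ≠ S
  fixed_north : f N = N
  fixed_south : f S = S
  tendsto_south : ∀ p : M, p ≠ N → p ≠ S →
    Filter.Tendsto (fun n : ℕ => (f ^ n) p) Filter.atTop (𝓝 S)
  tendsto_north : ∀ p : M, p ≠ N → p ≠ S →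
    Filter.Tendsto (fun n : ℕ => (f⁻¹ ^ n) p) Filter.atTop (𝓝 N)

/-- Uniform contraction near the fixed points: `f` contracts `B_r(S)` and `f⁻¹` contracts `B_r(N)` at
rate `μ`, and these balls have disjoint closures. -/
structure IsLocallyContracting (f : M ≃ₜ M) (N S : M) (r μ : ℝ) : Prop where
  r_pos : 0 < r
  mu_pos : 0 < μ
  mu_lt_one : μ < 1
  south : ∀ p ∈ Metric.ball S r, ∀ q ∈ Metric.ball S r, ∀ n : ℕ,
    dist ((f ^ n) p) ((f ^ n) q) ≤ μ ^ n * dist p q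
  north : ∀ p ∈ Metric.ball N r, ∀ q ∈ Metric.ball N r, ∀ n : ℕ,
    dist ((f⁻¹ ^ n) p) ((f⁻¹ ^ n) q) ≤ μ ^ n * dist p q
  disjoint : Disjoint (closure (Metric.ball N r)) (closure (Metric.ball S r))

/-- The region `U = {p | d(p, N) > r - δ, d(p, S) > r - δ}`. -/
def middleRegion (N S : M) (r δ : ℝ) : Set M :=
  {p | r - δ < dist p N ∧ r - δ < dist p S}

/-- The choice of the scale `δ` and of the time `u` for the bracket: `δ` is smaller than `r` and `ρ`,
geodesics between `δ`-close points `p, q` of `U` avoid the balls of radius `r / 2` about the poles,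
and `p`, `q`, `[p, q]` are in these balls at all times `i` with `|i| ≥ u`. -/
structure IsBracketScale (f : M ≃ₜ M) (N S : M) (r ρ : ℝ) (φ : C(M, Set.Icc (0 : ℝ) 1))
    (δ : ℝ) (u : ℕ) : Prop where
  delta_pos : 0 < δ
  delta_lt_r : δ < r
  delta_lt_rho : δ < ρ
  geodesic_avoids : ∀ p ∈ middleRegion N S r δ, ∀ q ∈ middleRegion N S r δ, dist p q < δ →
    ∀ g : ℝ → M, IsShortGeodesic ρ p q g → ∀ t ∈ Set.Icc (0 : ℝ) 1,
      g t ∉ Metric.ball N (r / 2) ∪ Metric.ball S (r / 2)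
  one_le_u : 1 ≤ u
  enters : ∀ p ∈ middleRegion N S r δ, ∀ q ∈ middleRegion N S r δ, dist p q < δ →
    ∀ i : ℤ, (u : ℤ) ≤ |i| →
      (f ^ i) p ∈ Metric.ball N (r / 2) ∪ Metric.ball S (r / 2) ∧
      (f ^ i) q ∈ Metric.ball N (r / 2) ∪ Metric.ball S (r / 2) ∧
      (f ^ i) (geodesicBracket ρ φ p q) ∈ Metric.ball N (r / 2) ∪ Metric.ball S (r / 2)

end NorthSouth

end NorthSouthShadowing

open NorthSouthShadowing

/-!
The distance of a compact Riemannian manifold is an infimum of lengths, so almost minimizing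
paths, reparametrized by distance, converge along an ultrafilter to minimizing geodesics
(`HasAlmostGeodesics.exists_isMinimizing`). Below the scale `ρ` geodesics are unique, hence the
bracket `[p, q]` is the point at distance `φ(p) d(p, q)` from `p` on the minimizing geodesic, and
it is continuous because limits of minimizing geodesics are minimizing. Two `γ`-close points are
either both near `N`, where `[p, q] = q`, or both near `S`, where `[p, q] = p`, or both in the
middle region, whose points are near a pole at all times `i` with `|i| ≥ u`; this gives
hyperbolicity (`isHyperbolicBracket_geodesicBracket`).

The rest, up to the failure of shift-invariance, holds for every hyperbolic bracket with
`c μ ^ m ≤ 1 / (2c)`. Let `a_n = d(f^m(q_n), x_{(n+1)m})` be the `n`-th jump. One step halves the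
jump and adds the error of the pseudo-orbit, `a_{n+1} ≤ a_n / 2 + d(f^m(x_{(n+1)m}), x_{(n+2)m})`,
while `f^{-nm}(q_n)` moves by at most `2^{-n-1} a_n`. So the limits exist, uniformly in `x`, and old or
distant jumps have an exponentially small effect: `Sh⁺(x)` follows `x` at every positive time
around which `x` is close to an orbit (`IsInducing.exists_dist_shPlus_le`). By time reversal, and
since `Sh(x) = [Sh⁻(x), Sh⁺(x)]` is asymptotic to `Sh⁺(x)` in the future and to `Sh⁻(x)` in the
past, `f^i(Sh(x))` is close to `x_i` as soon as `x` is close to an orbit on a window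
around `i` (`IsInducing.exists_window`). Comparing this with the same statement for
`σ^i(x)` at the time `0` gives both shadowing and self-tuning.

Finally, consider the pseudo-orbits which jump once, from the orbit of `p` to that of a nearby
point `q`. If the map were shift-invariant, its value could be computed at very late or very early
times, where the bracket is one of the two projections, so it would equal both a purely backward
limit and a purely forward limit, which involve brackets at the times on one side of the jump only
(`IsInducing.inducedMap_eq_backward`, `IsInducing.inducedMap_eq_forward`). These two expressions
show that if a jump at the time `1` gives the point `p`, so does a jump at the time `0`
(`IsInducing.inducedMap_splice_zero_eq`). But a jump near `S` gives a point of the orbit of `p`,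
and a jump near `N` a point of the orbit of `q ≠ p`.
-/

namespace NorthSouthShadowing

/-! ### Minimizing geodesics in compact length spaces -/

section LengthSpace

open Filter Set

variable {M : Type*} [MetricSpace M]

variable (M) in
/-- A metric form of the statement that distances are infima of lengths: any two points are joined
by a continuous path along which the triangle inequality is almost an equality. -/
def HasAlmostGeodesics : Prop :=
  ∀ (p q : M) (ε : ℝ), 0 < ε → ∃ g : ℝ → M, ContinuousOn g (Icc 0 1) ∧ g 0 = p ∧ g 1 = q ∧
    ∀ s t : ℝ, 0 ≤ s → s ≤ t → t ≤ 1 →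
      dist p (g s) + dist (g s) (g t) + dist (g t) q ≤ dist p q + ε

/-- `g`, restricted to `[0, 1]`, is a minimizing geodesic from `p` to `q` of constant speed. -/
structure IsMinimizing (p q : M) (g : ℝ → M) : Prop where
  zero : g 0 = p
  one : g 1 = q
  dist_eq : ∀ s ∈ Icc (0 : ℝ) 1, ∀ t ∈ Icc (0 : ℝ) 1, dist (g s) (g t) = |s - t| * dist p q

theorem hasAlmostGeodesics_of_isRiemannianManifold {E : Type*} [NormedAddCommGroup E]
    [NormedSpace ℝ E] {H : Type*} [TopologicalSpace H] (I : ModelWithCorners ℝ E H)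
    [ChartedSpace H M] [Bundle.RiemannianBundle (fun x : M => TangentSpace I x)]
    [IsRiemannianManifold I M] : HasAlmostGeodesics M := by
  intro p q ε hε
  have hlt : Manifold.riemannianEDist I p q < ENNReal.ofReal (dist p q + ε) := by
    rw [← IsRiemannianManifold.out (I := I) p q, edist_dist]
    exact (ENNReal.ofReal_lt_ofReal_iff (by positivity)).2 (by linarith)
  obtain ⟨g, g0, g1, hg, hlen⟩ := Manifold.exists_lt_of_riemannianEDist_lt hlt
  refine ⟨g, hg.continuousOn, g0, g1, fun s t hs hst ht => ?_⟩
  have key : ∀ a b : ℝ, 0 ≤ a → a ≤ b → b ≤ 1 →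
      edist (g a) (g b) ≤ Manifold.pathELength I g a b := by
    intro a b ha hab hb
    rw [IsRiemannianManifold.out (I := I) (g a) (g b)]
    exact Manifold.riemannianEDist_le_pathELength (hg.mono (Icc_subset_Icc ha hb)) rfl rfl hab
  have h1 := key 0 s le_rfl hs (hst.trans ht)
  have h2 := key s t hs hst ht
  have h3 := key t 1 (hs.trans hst) ht le_rfl
  have hsum : edist p (g s) + edist (g s) (g t) + edist (g t) q
      ≤ ENNReal.ofReal (dist p q + ε) := by
    rw [g0] at h1
    rw [g1] at h3
    refine ((add_le_add (add_le_add h1 h2) h3).trans_eq ?_).trans hlen.le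
    rw [Manifold.pathELength_add hs hst, Manifold.pathELength_add (hs.trans hst) ht]
  rw [edist_dist, edist_dist, edist_dist, ← ENNReal.ofReal_add dist_nonneg dist_nonneg,
    ← ENNReal.ofReal_add (by positivity) dist_nonneg] at hsum
  exact (ENNReal.ofReal_le_ofReal_iff (by positivity)).1 hsum

/-- Reparametrizing an almost geodesic path by the distance to its origin, which takes all
intermediate values, gives a possibly discontinuous map which is almost a minimizing geodesic. -/
theorem HasAlmostGeodesics.exists_almost_minimizing (hM : HasAlmostGeodesics M) (p q : M) {ε : ℝ}
    (hε : 0 < ε) : ∃ g : ℝ → M, g 0 = p ∧ g 1 = q ∧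
      ∀ s ∈ Icc (0 : ℝ) 1, ∀ t ∈ Icc (0 : ℝ) 1,
        |dist (g s) (g t) - |s - t| * dist p q| ≤ ε := by
  obtain ⟨g, gc, g0, g1, hg⟩ := hM p q ε hε
  have hex : ∀ s : ℝ, ∃ a ∈ Icc (0 : ℝ) 1, (s ∈ Icc (0 : ℝ) 1 → dist p (g a) = s * dist p q) ∧
      (s = 1 → a = 1) := by
    intro s
    by_cases hs : s ∈ Icc (0 : ℝ) 1
    · by_cases h1 : s = 1
      · exact ⟨1, by simp, fun _ => by rw [g1, h1, one_mul], fun _ => rfl⟩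
      · have hc : ContinuousOn (fun a => dist p (g a)) (Icc 0 1) := 
          (continuous_const.dist continuous_id).comp_continuousOn gc
        have hmem : s * dist p q ∈ Icc (dist p (g 0)) (dist p (g 1)) := by
          rw [g0, g1, dist_self]
          exact ⟨mul_nonneg hs.1 dist_nonneg, mul_le_of_le_one_left dist_nonneg hs.2⟩
        obtain ⟨a, ha, hav⟩ := intermediate_value_Icc zero_le_one hc hmem
        exact ⟨a, ha, fun _ => hav, fun h => absurd h h1⟩
    · exact ⟨1, by simp, fun h => absurd h hs, fun _ => rfl⟩
  choose a ha hda ha1 using hex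
  -- The estimate for parameters whose reparametrized times are ordered.
  have main : ∀ s ∈ Icc (0 : ℝ) 1, ∀ t ∈ Icc (0 : ℝ) 1, a s ≤ a t →
      |dist (g (a s)) (g (a t)) - |s - t| * dist p q| ≤ ε := by
    intro s hs t ht hst
    have h := hg (a s) (a t) (ha s).1 hst (ha t).2
    have hds := hda s hs
    have hdt := hda t ht
    have t1 := dist_triangle p (g (a t)) q
    have t2 := dist_triangle p (g (a s)) (g (a t))
    have t3 := dist_triangle_right p (g (a s)) (g (a t))
    have hD : 0 ≤ dist p q := dist_nonneg
    rw [abs_le]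
    rcases abs_cases (s - t) with ⟨e, _⟩ | ⟨e, _⟩ <;> rw [e] <;> constructor <;> nlinarith
  refine ⟨fun s => g (a s), ?_, ?_, fun s hs t ht => ?_⟩
  · have := hda 0 (by simp)
    rw [zero_mul, dist_eq_zero] at this
    exact this.symm
  · simp [ha1 1 rfl, g1]
  · rcases le_total (a s) (a t) with h | h
    · exact main s hs t ht h
    · rw [dist_comm (g (a s)), abs_sub_comm s t]
      exact main t ht s hs h

/-- Ultrafilter limits of almost minimizing geodesics exist and are minimizing geodesics; this
replaces the theorem of Arzelà and Ascoli. -/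
theorem exists_isMinimizing_of_ultrafilter [CompactSpace M] {ι : Type*} (U : Ultrafilter ι)
    {p q : M} {P Q : ι → M} {G : ι → ℝ → M} {ε : ι → ℝ} (hP : Tendsto P U (𝓝 p))
    (hQ : Tendsto Q U (𝓝 q)) (hε : Tendsto ε U (𝓝 0)) (h0 : ∀ i, G i 0 = P i)
    (h1 : ∀ i, G i 1 = Q i)
    (hG : ∀ i, ∀ s ∈ Icc (0 : ℝ) 1, ∀ t ∈ Icc (0 : ℝ) 1,
      |dist (G i s) (G i t) - |s - t| * dist (P i) (Q i)| ≤ ε i) :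
    ∃ g : ℝ → M, IsMinimizing p q g ∧ ∀ s, Tendsto (fun i => G i s) U (𝓝 (g s)) := by
  have hex : ∀ s : ℝ, ∃ z : M, Tendsto (fun i => G i s) U (𝓝 z) := by
    intro s
    obtain ⟨z, -, hz⟩ := isCompact_univ.ultrafilter_le_nhds (U.map fun i => G i s) (by simp)
    exact ⟨z, hz⟩
  choose g hg using hex
  refine ⟨g, ⟨?_, ?_, fun s hs t ht => ?_⟩, hg⟩
  · exact tendsto_nhds_unique (hg 0) (by simpa only [h0] using hP)
  · exact tendsto_nhds_unique (hg 1) (by simpa only [h1] using hQ)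
  · have l1 : Tendsto (fun i => |dist (G i s) (G i t) - |s - t| * dist (P i) (Q i)|) U
        (𝓝 |dist (g s) (g t) - |s - t| * dist p q|) :=
      (((hg s).dist (hg t)).sub ((hP.dist hQ).const_mul _)).abs
    have := le_of_tendsto_of_tendsto l1 hε (Eventually.of_forall fun i => hG i s hs t ht)
    exact sub_eq_zero.1 (abs_nonpos_iff.1 this)

theorem HasAlmostGeodesics.exists_isMinimizing [CompactSpace M] (hM : HasAlmostGeodesics M)
    (p q : M) : ∃ g : ℝ → M, IsMinimizing p q g := by
  choose G h0 h1 hG using fun n : ℕ =>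
    hM.exists_almost_minimizing p q (ε := 1 / ((n : ℝ) + 1)) (by positivity)
  obtain ⟨g, hg, -⟩ := exists_isMinimizing_of_ultrafilter (hyperfilter ℕ) (P := fun _ => p)
    (Q := fun _ => q) tendsto_const_nhds tendsto_const_nhds
    (tendsto_one_div_add_atTop_nhds_zero_nat.mono_left Nat.hyperfilter_le_atTop) h0 h1 hG
  exact ⟨g, hg⟩

theorem IsMinimizing.isShortGeodesic {p q : M} {g : ℝ → M} (hg : IsMinimizing p q g) {ρ : ℝ}
    (h : dist p q ≤ ρ) : IsShortGeodesic ρ p q g :=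
  ⟨⟨dist p q, h, dist_nonneg, fun _ _ => ⟨1, one_pos, fun s hs s' hs' _ _ =>
    by rw [hg.dist_eq s hs s' hs', mul_comm]⟩⟩, hg.zero, hg.one⟩

/-- Below the scale of injectivity of the exponential map, short geodesics are minimizing. -/
theorem IsShortGeodesic.isMinimizing [CompactSpace M] (hM : HasAlmostGeodesics M) {ρ : ℝ}
    (hexp : ExpInjective M ρ) {p q : M} (h : dist p q ≤ ρ) {g : ℝ → M}
    (hg : IsShortGeodesic ρ p q g) : IsMinimizing p q g := by
  obtain ⟨k, hk⟩ := hM.exists_isMinimizing p q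
  have e := hexp p q g k hg (hk.isShortGeodesic h)
  exact ⟨hg.2.1, hg.2.2, fun s hs t ht => by rw [e s hs, e t ht, hk.dist_eq s hs t ht]⟩

theorem geodesicBracket_eq [CompactSpace M] {ρ : ℝ}
    (hexp : ExpInjective M ρ) (φ : C(M, Icc (0 : ℝ) 1)) {p q : M} (h : dist p q ≤ ρ)
    {g : ℝ → M} (hg : IsMinimizing p q g) : geodesicBracket ρ φ p q = g (φ p) := by
  have hex : ∃ g : ℝ → M, IsShortGeodesic ρ p q g := ⟨g, hg.isShortGeodesic h⟩
  rw [geodesicBracket, dif_pos hex]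
  exact hexp p q _ _ hex.choose_spec (hg.isShortGeodesic h) _ (φ p).2

theorem dist_left_geodesicBracket [CompactSpace M] (hM : HasAlmostGeodesics M) {ρ : ℝ}
    (hexp : ExpInjective M ρ) (φ : C(M, Icc (0 : ℝ) 1)) {p q : M} (h : dist p q ≤ ρ) :
    dist p (geodesicBracket ρ φ p q) = φ p * dist p q := by
  obtain ⟨g, hg⟩ := hM.exists_isMinimizing p q
  rw [geodesicBracket_eq hexp φ h hg]
  have := hg.dist_eq 0 (by simp) (φ p) (φ p).2
  rw [hg.zero, zero_sub, abs_neg, abs_of_nonneg (φ p).2.1] at this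
  rw [this]

theorem dist_geodesicBracket_right [CompactSpace M] (hM : HasAlmostGeodesics M) {ρ : ℝ}
    (hexp : ExpInjective M ρ) (φ : C(M, Icc (0 : ℝ) 1)) {p q : M} (h : dist p q ≤ ρ) :
    dist (geodesicBracket ρ φ p q) q = (1 - φ p) * dist p q := by
  obtain ⟨g, hg⟩ := hM.exists_isMinimizing p q
  rw [geodesicBracket_eq hexp φ h hg]
  have := hg.dist_eq (φ p) (φ p).2 1 (by simp)
  rw [hg.one, abs_sub_comm, abs_of_nonneg (sub_nonneg.2 (φ p).2.2)] at this
  rw [this]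

theorem geodesicBracket_eq_right [CompactSpace M] (hM : HasAlmostGeodesics M) {ρ : ℝ}
    (hexp : ExpInjective M ρ) (φ : C(M, Icc (0 : ℝ) 1)) {p q : M} (h : dist p q ≤ ρ)
    (hp : (φ p : ℝ) = 1) : geodesicBracket ρ φ p q = q := by
  rw [← dist_eq_zero, dist_geodesicBracket_right hM hexp φ h, hp, sub_self, zero_mul]

theorem geodesicBracket_eq_left_iff [CompactSpace M] (hM : HasAlmostGeodesics M) {ρ : ℝ}
    (hexp : ExpInjective M ρ) (φ : C(M, Icc (0 : ℝ) 1)) {p q : M} (h : dist p q ≤ ρ) :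
    geodesicBracket ρ φ p q = p ↔ (φ p : ℝ) = 0 ∨ p = q := by
  rw [eq_comm, ← dist_eq_zero, dist_left_geodesicBracket hM hexp φ h, mul_eq_zero, dist_eq_zero]

theorem geodesicBracket_self [CompactSpace M] (hM : HasAlmostGeodesics M) {ρ : ℝ} (hρ : 0 ≤ ρ)
    (hexp : ExpInjective M ρ) (φ : C(M, Icc (0 : ℝ) 1)) (p : M) :
    geodesicBracket ρ φ p p = p :=
  (geodesicBracket_eq_left_iff hM hexp φ (by simpa using hρ)).2 (Or.inr rfl)

theorem continuousOn_geodesicBracket [CompactSpace M] (hM : HasAlmostGeodesics M) {ρ : ℝ}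
    (hexp : ExpInjective M ρ) (φ : C(M, Icc (0 : ℝ) 1)) :
    ContinuousOn (fun z : M × M => geodesicBracket ρ φ z.1 z.2) {z | dist z.1 z.2 ≤ ρ} := by
  rintro ⟨p, q⟩ hpq
  rw [ContinuousWithinAt, tendsto_iff_ultrafilter]
  intro U hU
  have hU1 : ∀ᶠ z in (U : Filter (M × M)), dist z.1 z.2 ≤ ρ :=
    hU self_mem_nhdsWithin
  have hU2 : (U : Filter (M × M)) ≤ 𝓝 (p, q) := hU.trans nhdsWithin_le_nhds
  choose G hG using fun z : M × M => hM.exists_isMinimizing z.1 z.2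
  have hP : Tendsto (fun z : M × M => z.1) U (𝓝 p) := continuous_fst.continuousAt.mono_left hU2
  have hQ : Tendsto (fun z : M × M => z.2) U (𝓝 q) := continuous_snd.continuousAt.mono_left hU2
  obtain ⟨g, hg, hlim⟩ := exists_isMinimizing_of_ultrafilter U (G := G) hP hQ
    (tendsto_const_nhds (x := (0 : ℝ))) (fun z => (hG z).zero) (fun z => (hG z).one)
    (fun z s hs t ht => by rw [(hG z).dist_eq s hs t ht, sub_self, abs_zero])
  have hφ : Tendsto (fun z : M × M => (φ z.1 : ℝ)) U (𝓝 (φ p)) :=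
    ((continuous_subtype_val.comp φ.continuous).tendsto p).comp hP
  -- The parameter varies with the geodesic, at bounded speed.
  have hmove : Tendsto (fun z : M × M => dist (G z (φ p)) (G z (φ z.1))) U (𝓝 0) := by
    have : Tendsto (fun z : M × M => |(φ p : ℝ) - φ z.1| * dist z.1 z.2) U
        (𝓝 (|(φ p : ℝ) - φ p| * dist p q)) :=
      (tendsto_const_nhds.sub hφ).abs.mul (hP.dist hQ)
    rw [sub_self, abs_zero, zero_mul] at this
    exact this.congr fun z => ((hG z).dist_eq _ (φ p).2 _ (φ z.1).2).symm
  have hval : geodesicBracket ρ φ p q = g (φ p) := geodesicBracket_eq hexp φ hpq hg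
  have := (hlim (φ p)).congr_dist hmove
  simp only [hval]
  refine this.congr' ?_
  filter_upwards [hU1] with z hz
  exact (geodesicBracket_eq hexp φ hz (hG z)).symm

end LengthSpace

/-! ### The forward limit of a hyperbolic bracket -/

section ForwardLimit

open Filter Set

variable {M : Type*} [MetricSpace M]

/-- The standing hypotheses of the construction of the map induced by a bracket: the bracket is
`(c, μ)`-hyperbolic, `f` and `f⁻¹` are `L`-Lipschitz, and the time step `m` satisfies
`c μ ^ m ≤ 1 / (2c)`. -/
structure IsInducing (f : M ≃ₜ M) (B : M → M → M) (γ c μ : ℝ) (m : ℕ) (L : ℝ) : Prop where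
  bracket : IsHyperbolicBracket f B γ c μ
  lip : ∀ p q, dist (f p) (f q) ≤ L * dist p q
  lip_inv : ∀ p q, dist (f⁻¹ p) (f⁻¹ q) ≤ L * dist p q
  one_le : 1 ≤ L
  rate : c * μ ^ m ≤ 1 / (2 * c)

theorem IsHyperbolicBracket.flip {f : M ≃ₜ M} {B : M → M → M} {γ c μ : ℝ}
    (h : IsHyperbolicBracket f B γ c μ) : IsHyperbolicBracket f⁻¹ (flipBracket B) γ c μ where
  gamma_pos := h.gamma_pos
  one_le_c := h.one_le_c
  mu_pos := h.mu_pos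
  mu_lt_one := h.mu_lt_one
  continuousOn := h.continuousOn.comp continuous_swap.continuousOn fun z hz => by
    simpa [dist_comm] using hz
  diag := h.diag
  forward p q hpq n := by
    rw [dist_comm p q] at hpq ⊢
    exact h.backward q p hpq n
  backward p q hpq n := by
    rw [dist_comm p q] at hpq ⊢
    rw [inv_inv]
    exact h.forward q p hpq n

theorem IsInducing.flip {f : M ≃ₜ M} {B : M → M → M} {γ c μ L : ℝ} {m : ℕ}
    (h : IsInducing f B γ c μ m L) : IsInducing f⁻¹ (flipBracket B) γ c μ m L where
  bracket := h.bracket.flip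
  lip := h.lip_inv
  lip_inv := by simpa only [inv_inv] using h.lip
  one_le := h.one_le
  rate := h.rate

theorem dist_pow_le {f : M ≃ₜ M} {L : ℝ} (hL : ∀ p q, dist (f p) (f q) ≤ L * dist p q)
    (h1 : 1 ≤ L) (n : ℕ) (p q : M) : dist ((f ^ n) p) ((f ^ n) q) ≤ L ^ n * dist p q := by
  induction n with
  | zero => simp
  | succ n ih =>
    rw [pow_succ' f, Homeomorph.mul_apply, Homeomorph.mul_apply, pow_succ', mul_assoc]
    exact (hL _ _).trans (by gcongr)

@[simp]
theorem inv_pow_apply_pow_apply (f : M ≃ₜ M) (n : ℕ) (p : M) : (f⁻¹ ^ n) ((f ^ n) p) = p := by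
  rw [← Homeomorph.mul_apply, inv_pow, inv_mul_cancel, Homeomorph.one_apply]

@[simp]
theorem pow_apply_inv_pow_apply (f : M ≃ₜ M) (n : ℕ) (p : M) : (f ^ n) ((f⁻¹ ^ n) p) = p := by
  rw [← Homeomorph.mul_apply, inv_pow, mul_inv_cancel, Homeomorph.one_apply]

theorem pow_add_apply (f : M ≃ₜ M) (a b : ℕ) (p : M) :
    (f ^ (a + b)) p = (f ^ a) ((f ^ b) p) := by
  rw [pow_add, Homeomorph.mul_apply]

theorem zpow_add_apply (f : M ≃ₜ M) (a b : ℤ) (p : M) :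
    (f ^ (a + b)) p = (f ^ a) ((f ^ b) p) := by
  rw [zpow_add, Homeomorph.mul_apply]

/-- The distance between the two arguments of the bracket defining `q_{n+1}`. -/
def jump (f : M ≃ₜ M) (B : M → M → M) (m : ℕ) (x : ℤ → M) (n : ℕ) : ℝ :=
  dist ((f ^ m) (qSeq f B m x n)) (x (((n + 1) * m : ℕ) : ℤ))

/-- The error of the pseudo-orbit `x` between the times `nm` and `(n + 1)m`. -/
def stepError (f : M ≃ₜ M) (m : ℕ) (x : ℤ → M) (n : ℕ) : ℝ :=
  dist ((f ^ m) (x ((n * m : ℕ) : ℤ))) (x (((n + 1) * m : ℕ) : ℤ))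

section

variable {f : M ≃ₜ M} {B : M → M → M} {γ c μ L : ℝ} {m : ℕ} {x : ℤ → M}

theorem jump_nonneg (n : ℕ) : 0 ≤ jump f B m x n := dist_nonneg

theorem IsInducing.c_mul_rate_le (h : IsInducing f B γ c μ m L) : c * μ ^ m ≤ 1 / 2 := by
  refine h.rate.trans ?_
  have := h.bracket.one_le_c
  gcongr
  linarith

theorem IsInducing.rate_le (h : IsInducing f B γ c μ m L) : μ ^ m ≤ 1 / 2 :=
  (le_mul_of_one_le_left (pow_nonneg h.bracket.mu_pos.le _) h.bracket.one_le_c).trans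
    h.c_mul_rate_le

theorem IsInducing.m_pos (h : IsInducing f B γ c μ m L) : 0 < m := by
  rcases Nat.eq_zero_or_pos m with rfl | hm
  · have := h.rate_le
    norm_num at this
  · exact hm

theorem IsInducing.c_mul_pow_le (h : IsInducing f B γ c μ m L) (j : ℕ) :
    c * μ ^ ((j + 1) * m) ≤ (1 / 2) ^ (j + 1) := by
  have h0 : 0 ≤ μ ^ m := pow_nonneg h.bracket.mu_pos.le _
  have h1 := h.rate_le
  have h2 := h.c_mul_rate_le
  calc c * μ ^ ((j + 1) * m) = (c * μ ^ m) * (μ ^ m) ^ j := by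
        rw [mul_comm (j + 1) m, pow_mul, pow_succ]; ring
    _ ≤ (1 / 2) * (1 / 2) ^ j := by gcongr
    _ = (1 / 2) ^ (j + 1) := by rw [pow_succ]; ring

theorem jump_zero : jump f B m x 0 = stepError f m x 0 := by
  simp [jump, stepError, qSeq]

theorem IsInducing.jump_succ_le (h : IsInducing f B γ c μ m L) (hx : BracketsApply f B γ m x)
    (n : ℕ) : jump f B m x (n + 1) ≤ jump f B m x n / 2 + stepError f m x (n + 1) := by
  have h1 := h.bracket.forward _ _ (hx n) m
  have h2 : c * μ ^ m * jump f B m x n ≤ 1 / 2 * jump f B m x n :=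
    mul_le_mul_of_nonneg_right h.c_mul_rate_le (jump_nonneg n)
  have h3 := dist_triangle ((f ^ m) (qSeq f B m x (n + 1)))
    ((f ^ m) (x (((n + 1) * m : ℕ) : ℤ))) (x (((n + 1 + 1) * m : ℕ) : ℤ))
  rw [jump] at h2
  simp only [jump, stepError, qSeq] at *
  linarith

theorem IsInducing.jump_add_le (h : IsInducing f B γ c μ m L) (hx : BracketsApply f B γ m x)
    {b : ℝ} (n k : ℕ) (hb : ∀ i < k, stepError f m x (n + i + 1) ≤ b) :
    jump f B m x (n + k) ≤ (1 / 2) ^ k * jump f B m x n + 2 * (1 - (1 / 2) ^ k) * b := by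
  induction k with
  | zero => simp
  | succ k ih =>
    have h1 := ih fun i hi => hb i (by omega)
    have h2 := h.jump_succ_le hx (n + k)
    have h3 := hb k (by omega)
    rw [← add_assoc, pow_succ]
    linarith

theorem IsInducing.dist_qSeq_succ_le (h : IsInducing f B γ c μ m L)
    (hx : BracketsApply f B γ m x) (n : ℕ) :
    dist (qSeq f B m x (n + 1)) (x (((n + 1) * m : ℕ) : ℤ)) ≤ c * jump f B m x n := by
  simpa [qSeq, jump] using h.bracket.forward _ _ (hx n) 0

theorem pow_apply_pSeq (N j : ℕ) :
    (f ^ (N * m)) (pSeq f B m x (N + j)) = (f⁻¹ ^ (j * m)) (qSeq f B m x (N + j)) := by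
  rw [pSeq, add_mul, pow_add_apply, pow_apply_inv_pow_apply]

theorem IsInducing.dist_pSeq_succ_le (h : IsInducing f B γ c μ m L)
    (hx : BracketsApply f B γ m x) (N j : ℕ) :
    dist ((f ^ (N * m)) (pSeq f B m x (N + (j + 1)))) ((f ^ (N * m)) (pSeq f B m x (N + j)))
      ≤ (1 / 2) ^ (j + 1) * jump f B m x (N + j) := by
  have e : (f⁻¹ ^ (j * m)) (qSeq f B m x (N + j))
      = (f⁻¹ ^ ((j + 1) * m)) ((f ^ m) (qSeq f B m x (N + j))) := by
    rw [add_mul, one_mul, pow_add_apply, inv_pow_apply_pow_apply]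
  rw [pow_apply_pSeq, pow_apply_pSeq, e]
  refine (h.bracket.backward _ _ (hx (N + j)) ((j + 1) * m)).trans ?_
  exact mul_le_mul_of_nonneg_right (h.c_mul_pow_le j) dist_nonneg

theorem IsInducing.dist_pSeq_add_le (h : IsInducing f B γ c μ m L)
    (hx : BracketsApply f B γ m x) {β : ℝ} (N V k : ℕ)
    (hβ : ∀ i < k, jump f B m x (N + V + i) ≤ β) :
    dist ((f ^ (N * m)) (pSeq f B m x (N + (V + k)))) ((f ^ (N * m)) (pSeq f B m x (N + V)))
      ≤ β * (1 / 2) ^ V * (1 - (1 / 2) ^ k) := by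
  induction k with
  | zero => simp
  | succ k ih =>
    have h1 := ih fun i hi => hβ i (by omega)
    have h2 := h.dist_pSeq_succ_le hx N (V + k)
    have h3 : (1 / 2 : ℝ) ^ (V + k + 1) * jump f B m x (N + (V + k))
        ≤ (1 / 2) ^ (V + k + 1) * β := by
      have := hβ k (by omega)
      rw [add_assoc] at this
      gcongr
    have h4 := dist_triangle ((f ^ (N * m)) (pSeq f B m x (N + (V + k + 1))))
      ((f ^ (N * m)) (pSeq f B m x (N + (V + k)))) ((f ^ (N * m)) (pSeq f B m x (N + V)))
    rw [← add_assoc V k 1]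
    rw [pow_succ (1 / 2 : ℝ) (V + k), pow_add (1 / 2 : ℝ) V k] at h2 h3
    rw [pow_succ]
    linarith

theorem IsInducing.tendsto_pSeq [CompleteSpace M] (h : IsInducing f B γ c μ m L)
    (hx : BracketsApply f B γ m x) :
    Tendsto (pSeq f B m x) atTop (𝓝 (shPlus f B m x)) := by
  have hc : CauchySeq (pSeq f B m x) := by
    refine cauchySeq_of_le_geometric (1 / 2) γ (by norm_num) fun n => ?_
    have h1 := h.dist_pSeq_succ_le hx 0 n
    simp only [zero_mul, pow_zero, Homeomorph.one_apply, zero_add] at h1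
    have h2 : (1 / 2 : ℝ) ^ (n + 1) * jump f B m x n ≤ (1 / 2) ^ n * γ := by
      have h3 : (1 / 2 : ℝ) ^ (n + 1) ≤ (1 / 2) ^ n :=
        pow_le_pow_of_le_one (by norm_num) (by norm_num) (Nat.le_succ n)
      exact mul_le_mul h3 (hx n) (jump_nonneg n) (by positivity)
    rw [dist_comm]
    linarith
  exact tendsto_nhds_limUnder (cauchySeq_tendsto_of_complete hc)

theorem IsInducing.dist_shPlus_pSeq_le [CompleteSpace M] (h : IsInducing f B γ c μ m L)
    (hx : BracketsApply f B γ m x) {β : ℝ} (N V : ℕ)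
    (hβ : ∀ i, jump f B m x (N + V + i) ≤ β) :
    dist ((f ^ (N * m)) (shPlus f B m x)) ((f ^ (N * m)) (pSeq f B m x (N + V)))
      ≤ β * (1 / 2) ^ V := by
  have hβ0 : 0 ≤ β := (jump_nonneg _).trans (hβ 0)
  have hlim : Tendsto (fun k => (f ^ (N * m)) (pSeq f B m x (N + (V + k)))) atTop
      (𝓝 ((f ^ (N * m)) (shPlus f B m x))) := by
    have := ((f ^ (N * m)).continuous.tendsto _).comp
      ((h.tendsto_pSeq hx).comp (tendsto_add_atTop_nat (N + V)))
    refine this.congr fun k => ?_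
    simp only [Function.comp_apply]
    rw [add_comm k, add_assoc]
  refine le_of_tendsto (hlim.dist tendsto_const_nhds) (Eventually.of_forall fun k => ?_)
  refine (h.dist_pSeq_add_le hx N V k fun i _ => hβ i).trans ?_
  refine mul_le_of_le_one_right (by positivity) ?_
  have : (0 : ℝ) ≤ (1 / 2) ^ k := by positivity
  linarith

/-- If the jumps are at most `α` during `W` steps from the step `N` on and at most `β` afterwards,
then `f ^ (Nm)` maps the forward limit close to `q_N`. -/
theorem IsInducing.dist_shPlus_qSeq_le [CompleteSpace M] (h : IsInducing f B γ c μ m L)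
    (hx : BracketsApply f B γ m x) {α β : ℝ} (hα : 0 ≤ α) (N W : ℕ)
    (hα' : ∀ i < W, jump f B m x (N + i) ≤ α) (hβ : ∀ i, jump f B m x (N + W + i) ≤ β) :
    dist ((f ^ (N * m)) (shPlus f B m x)) (qSeq f B m x N) ≤ α + β * (1 / 2) ^ W := by
  have h1 := h.dist_shPlus_pSeq_le hx N W hβ
  have h2 := h.dist_pSeq_add_le hx N 0 W (β := α) hα'
  have h3 : (f ^ (N * m)) (pSeq f B m x (N + 0)) = qSeq f B m x N := by
    rw [pow_apply_pSeq]; simp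
  rw [h3] at h2
  have h4 : α * (1 / 2) ^ 0 * (1 - (1 / 2) ^ W) ≤ α := by
    have : (0 : ℝ) ≤ (1 / 2) ^ W := by positivity
    rw [pow_zero, mul_one]
    exact mul_le_of_le_one_right hα (by linarith)
  rw [zero_add] at h2
  have := dist_triangle ((f ^ (N * m)) (shPlus f B m x))
    ((f ^ (N * m)) (pSeq f B m x (N + W))) (qSeq f B m x N)
  linarith

theorem IsInducing.continuousOn_qSeq (h : IsInducing f B γ c μ m L) (n : ℕ) :
    ContinuousOn (fun x => qSeq f B m x n) {x | BracketsApply f B γ m x} := by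
  induction n with
  | zero => exact (continuous_apply 0).continuousOn
  | succ n ih =>
    have hpair : ContinuousOn (fun x : ℤ → M =>
        (((f ^ m) (qSeq f B m x n), x (((n + 1) * m : ℕ) : ℤ)) : M × M))
        {x | BracketsApply f B γ m x} :=
      ((f ^ m).continuous.comp_continuousOn ih).prodMk (continuous_apply _).continuousOn
    exact h.bracket.continuousOn.comp hpair fun x hx => hx n

theorem IsInducing.continuousOn_shPlus [CompleteSpace M] (h : IsInducing f B γ c μ m L) :
    ContinuousOn (shPlus f B m) {x | BracketsApply f B γ m x} := by
  have hu : TendstoUniformlyOn (fun n x => pSeq f B m x n) (shPlus f B m) atTop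
      {x | BracketsApply f B γ m x} := by
    rw [Metric.tendstoUniformlyOn_iff]
    intro ε hε
    have hlim : Tendsto (fun n : ℕ => γ * (1 / 2 : ℝ) ^ n) atTop (𝓝 0) := by
      simpa using (tendsto_pow_atTop_nhds_zero_of_lt_one (r := (1 / 2 : ℝ))
        (by norm_num) (by norm_num)).const_mul γ
    filter_upwards [hlim.eventually (gt_mem_nhds hε)] with n hn x hx
    have := h.dist_shPlus_pSeq_le hx 0 n (β := γ) fun i => hx _
    simp only [zero_mul, pow_zero, Homeomorph.one_apply, zero_add] at this
    exact this.trans_lt hn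
  refine hu.continuousOn (Eventually.frequently (Eventually.of_forall fun n => ?_))
  exact (f⁻¹ ^ (n * m)).continuous.comp_continuousOn (h.continuousOn_qSeq n)

theorem qSeq_eq_of_orbit (hdiag : ∀ p, B p p = p) {p : M} (n : ℕ)
    (hx : ∀ k ≤ n, x ((k * m : ℕ) : ℤ) = (f ^ (k * m)) p) :
    qSeq f B m x n = (f ^ (n * m)) p := by
  induction n with
  | zero => simpa [qSeq] using hx 0 le_rfl
  | succ n ih =>
    rw [qSeq, ih fun k hk => hx k (by omega), hx (n + 1) le_rfl, ← pow_add_apply, add_comm m,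
      ← Nat.succ_mul, hdiag]

theorem shPlus_eq_of_eventually {p : M} (hp : ∀ᶠ n in atTop, pSeq f B m x n = p) :
    shPlus f B m x = p := by
  have : Nonempty M := ⟨p⟩
  exact (tendsto_const_nhds.congr' (hp.mono fun n hn => hn.symm)).limUnder_eq

theorem shPlus_eq_of_orbit (hdiag : ∀ p, B p p = p) {p : M}
    (hx : ∀ k : ℕ, x ((k * m : ℕ) : ℤ) = (f ^ (k * m)) p) : shPlus f B m x = p := by
  refine shPlus_eq_of_eventually (Eventually.of_forall fun n => ?_)
  rw [pSeq, qSeq_eq_of_orbit hdiag n fun k _ => hx k, inv_pow_apply_pow_apply]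

end

end ForwardLimit

/-! ### The induced map: time reversal, continuity, domain -/

section InducedMap

open Filter Set

variable {M : Type*} [MetricSpace M]

/-- The part of `ConstructionApplies` which concerns a single sequence. -/
def AppliesAt (f : M ≃ₜ M) (B : M → M → M) (γ : ℝ) (m : ℕ) (x : ℤ → M) : Prop :=
  BracketsApply f B γ m x ∧ BracketsApply f⁻¹ (flipBracket B) γ m (reverseSeq x) ∧
    dist (shMinus f B m x) (shPlus f B m x) ≤ γ

theorem reverseSeq_reverseSeq {X : Type*} (x : ℤ → X) : reverseSeq (reverseSeq x) = x := by
  funext i; simp [reverseSeq]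

theorem shMinus_inv_reverseSeq (f : M ≃ₜ M) (B : M → M → M) (m : ℕ) (x : ℤ → M) :
    shMinus f⁻¹ (flipBracket B) m (reverseSeq x) = shPlus f B m x := by
  rw [shMinus, reverseSeq_reverseSeq, inv_inv]; rfl

theorem inducedMap_inv_reverseSeq (f : M ≃ₜ M) (B : M → M → M) (m : ℕ) (x : ℤ → M) :
    inducedMap f⁻¹ (flipBracket B) m (reverseSeq x) = inducedMap f B m x := by
  rw [inducedMap, shMinus_inv_reverseSeq]; rfl

theorem AppliesAt.reverse {f : M ≃ₜ M} {B : M → M → M} {γ : ℝ} {m : ℕ} {x : ℤ → M}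
    (h : AppliesAt f B γ m x) : AppliesAt f⁻¹ (flipBracket B) γ m (reverseSeq x) := by
  refine ⟨h.2.1, ?_, ?_⟩
  · rw [reverseSeq_reverseSeq, inv_inv]; exact h.1
  · rw [shMinus_inv_reverseSeq, dist_comm]; exact h.2.2

theorem shiftPow_mem_pseudoOrbits {f : M ≃ₜ M} {δ : ℝ} {x : ℤ → M} (hx : x ∈ pseudoOrbits f δ)
    (i : ℤ) : shiftPow i x ∈ pseudoOrbits f δ := fun j => by
  simpa [shiftPow, add_right_comm] using hx (j + i)

theorem pseudoOrbits_mono (f : M ≃ₜ M) {δ δ' : ℝ} (h : δ ≤ δ') :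
    pseudoOrbits f δ ⊆ pseudoOrbits f δ' := fun _ hx i => (hx i).trans h

theorem orbitMap_succ (f : M ≃ₜ M) (p : M) (i : ℤ) :
    orbitMap f p (i + 1) = f (orbitMap f p i) := by
  rw [orbitMap, orbitMap, add_comm, zpow_add_apply, zpow_one]

theorem reverseSeq_mem_pseudoOrbits {f : M ≃ₜ M} {L δ : ℝ}
    (hL' : ∀ p q, dist (f⁻¹ p) (f⁻¹ q) ≤ L * dist p q) (hL0 : 0 ≤ L) {x : ℤ → M}
    (hx : x ∈ pseudoOrbits f δ) : reverseSeq x ∈ pseudoOrbits f⁻¹ (L * δ) := by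
  intro i
  have h1 := hx (-(i + 1))
  have h2 := hL' (f (x (-(i + 1)))) (x (-(i + 1) + 1))
  have h3 : f⁻¹ (f (x (-(i + 1)))) = x (-(i + 1)) := by
    simp
  have h4 : -(i + 1) + 1 = -i := by ring
  rw [h3, h4] at h2
  rw [h4, dist_comm] at h1
  exact h2.trans (mul_le_mul_of_nonneg_left h1 hL0)

/-- Along a `δ`-orbit, the error accumulated in `n` steps is at most
`(1 + L + ⋯ + L ^ (n - 1)) δ`. -/
theorem dist_pow_apply_le {f : M ≃ₜ M} {L δ : ℝ} (hL : ∀ p q, dist (f p) (f q) ≤ L * dist p q)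
    (hL0 : 0 ≤ L) {x : ℤ → M} (hx : x ∈ pseudoOrbits f δ) (i : ℤ) (n : ℕ) :
    dist ((f ^ n) (x i)) (x (i + n)) ≤ (∑ k ∈ Finset.range n, L ^ k) * δ := by
  induction n with
  | zero => simp
  | succ n ih =>
    have h1 := hx (i + n)
    have h2 := hL ((f ^ n) (x i)) (x (i + n))
    have h3 := dist_triangle_right (f ((f ^ n) (x i))) (x (i + n + 1)) (f (x (i + n)))
    have h4 : L * dist ((f ^ n) (x i)) (x (i + n)) ≤ L * ((∑ k ∈ Finset.range n, L ^ k) * δ) :=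
      mul_le_mul_of_nonneg_left ih hL0
    rw [geom_sum_succ, pow_succ' f, Homeomorph.mul_apply, Nat.cast_succ, ← add_assoc]
    linarith

variable {f : M ≃ₜ M} {B : M → M → M} {γ c μ L : ℝ} {m : ℕ} {x : ℤ → M}

/-- If the construction of the forward limit is applied to a sequence whose errors over `m` steps
are at most `A ≤ γ / 2`, then all the brackets are defined, and the limit is close to `x_0`. -/
theorem IsInducing.bracketsApply_of_stepError_le (h : IsInducing f B γ c μ m L) {A : ℝ}
    (hA : 2 * A ≤ γ) (hx : ∀ n, stepError f m x n ≤ A) :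
    BracketsApply f B γ m x ∧ ∀ n, jump f B m x n ≤ 2 * A := by
  have hA0 : 0 ≤ A := dist_nonneg.trans (hx 0)
  have hj : ∀ n, jump f B m x n ≤ 2 * A := by
    intro n
    induction n with
    | zero => rw [jump_zero]; linarith [hx 0]
    | succ n ih =>
      have h1 := h.bracket.forward _ _ (ih.trans hA) m
      have h2 : c * μ ^ m * jump f B m x n ≤ 1 / 2 * (2 * A) :=
        mul_le_mul h.c_mul_rate_le ih dist_nonneg (by norm_num)
      have h3 := dist_triangle ((f ^ m) (qSeq f B m x (n + 1)))
        ((f ^ m) (x (((n + 1) * m : ℕ) : ℤ))) (x (((n + 1 + 1) * m : ℕ) : ℤ))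
      have h4 := hx (n + 1)
      simp only [jump, stepError, qSeq] at *
      linarith
  exact ⟨fun n => (hj n).trans hA, hj⟩

theorem IsInducing.dist_shPlus_zero_le [CompleteSpace M] (h : IsInducing f B γ c μ m L)
    (hx : BracketsApply f B γ m x) {β : ℝ} (hβ : ∀ n, jump f B m x n ≤ β) :
    dist (shPlus f B m x) (x 0) ≤ β := by
  simpa [qSeq] using h.dist_shPlus_qSeq_le hx (α := 0) le_rfl 0 0 (by simp) fun i => hβ _

theorem stepError_le_of_mem_pseudoOrbits {δ : ℝ}
    (hL : ∀ p q, dist (f p) (f q) ≤ L * dist p q) (hL0 : 0 ≤ L) (hx : x ∈ pseudoOrbits f δ)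
    (n : ℕ) : stepError f m x n ≤ (∑ k ∈ Finset.range m, L ^ k) * δ := by
  have := dist_pow_apply_le hL hL0 hx ((n * m : ℕ) : ℤ) m
  rwa [← Nat.cast_add, ← Nat.succ_mul] at this

theorem IsInducing.constructionApplies [CompleteSpace M] (h : IsInducing f B γ c μ m L) {δ : ℝ}
    (hδ : 0 < δ) (hγ : 4 * L * (∑ i ∈ Finset.range m, L ^ i) * δ ≤ γ) :
    ConstructionApplies f B γ m δ := by
  intro x hx
  have hL0 : 0 ≤ L := zero_le_one.trans h.one_le
  set A := (∑ i ∈ Finset.range m, L ^ i) * δ with hAdef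
  have hA0 : 0 ≤ A := by positivity
  have hAL : A ≤ L * A := le_mul_of_one_le_left hA0 h.one_le
  have hAγ : 4 * (L * A) ≤ γ := by rw [hAdef]; linarith
  have hx1 := fun n => stepError_le_of_mem_pseudoOrbits (m := m) h.lip hL0 hx n
  have hx2 : ∀ n, stepError f⁻¹ m (reverseSeq x) n ≤ L * A := fun n =>
    (stepError_le_of_mem_pseudoOrbits (m := m) h.lip_inv hL0
      (reverseSeq_mem_pseudoOrbits h.lip_inv hL0 hx) n).trans_eq (by rw [hAdef]; ring)
  obtain ⟨b1, j1⟩ := h.bracketsApply_of_stepError_le (by linarith) hx1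
  obtain ⟨b2, j2⟩ := h.flip.bracketsApply_of_stepError_le (by linarith) hx2
  have d1 := h.dist_shPlus_zero_le b1 j1
  have d2 : dist (shMinus f B m x) (x 0) ≤ 2 * (L * A) := h.flip.dist_shPlus_zero_le b2 j2
  refine ⟨b1, b2, ?_⟩
  have := dist_triangle_right (shMinus f B m x) (shPlus f B m x) (x 0)
  linarith

theorem continuous_reverseSeq : Continuous (reverseSeq : (ℤ → M) → ℤ → M) :=
  continuous_pi fun i => continuous_apply (-i)

theorem IsInducing.continuousOn_inducedMap [CompleteSpace M] (h : IsInducing f B γ c μ m L) :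
    ContinuousOn (inducedMap f B m) {x | AppliesAt f B γ m x} := by
  have h1 : ContinuousOn (shPlus f B m) {x | AppliesAt f B γ m x} :=
    h.continuousOn_shPlus.mono fun x hx => hx.1
  have h2 : ContinuousOn (shMinus f B m) {x | AppliesAt f B γ m x} :=
    h.flip.continuousOn_shPlus.comp continuous_reverseSeq.continuousOn fun x hx => hx.2.1
  exact h.bracket.continuousOn.comp (h2.prodMk h1) fun x hx => hx.2.2

theorem shMinus_eq_of_orbit (hdiag : ∀ p, B p p = p) {p : M}
    (hx : ∀ k : ℕ, x (-((k * m : ℕ) : ℤ)) = (f⁻¹ ^ (k * m)) p) : shMinus f B m x = p :=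
  shPlus_eq_of_orbit (B := flipBracket B) hdiag hx

theorem zpow_neg_natCast_apply (f : M ≃ₜ M) (n : ℕ) (p : M) :
    (f ^ (-(n : ℤ))) p = (f⁻¹ ^ n) p := by
  rw [zpow_neg, zpow_natCast, inv_pow]

theorem IsInducing.isPseudoOrbitMap [CompleteSpace M] (h : IsInducing f B γ c μ m L) {δ : ℝ}
    (hδ : ConstructionApplies f B γ m δ) : IsPseudoOrbitMap f δ (inducedMap f B m) where
  continuousOn := h.continuousOn_inducedMap.mono fun x hx => hδ x hx
  orbit p := by
    have h1 : shPlus f B m (orbitMap f p) = p :=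
      shPlus_eq_of_orbit h.bracket.diag fun k => by rw [orbitMap, zpow_natCast]
    have h2 : shMinus f B m (orbitMap f p) = p :=
      shMinus_eq_of_orbit h.bracket.diag fun k => zpow_neg_natCast_apply f _ p
    rw [inducedMap, h1, h2, h.bracket.diag]

end InducedMap

/-! ### Shadowing and self-tuning -/

section Shadowing

open Filter Set

variable {M : Type*} [MetricSpace M]

/-- On the window of radius `R` around the time `i`, the sequence `x` is `η`-close to the orbit
of `x_i`. -/
def IsOrbitWindow (f : M ≃ₜ M) (x : ℤ → M) (i : ℤ) (R : ℕ) (η : ℝ) : Prop :=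
  ∀ j : ℤ, j.natAbs ≤ R → dist (x (i + j)) ((f ^ j) (x i)) ≤ η

variable {f : M ≃ₜ M} {B : M → M → M} {γ c μ L : ℝ} {m : ℕ} {x : ℤ → M}

theorem IsOrbitWindow.mono {i : ℤ} {R R' : ℕ} {η η' : ℝ} (h : IsOrbitWindow f x i R' η)
    (hR : R ≤ R') (hη : η ≤ η') : IsOrbitWindow f x i R η' := fun j hj =>
  (h j (hj.trans hR)).trans hη

theorem IsOrbitWindow.reverse {i : ℤ} {R : ℕ} {η : ℝ} (h : IsOrbitWindow f x i R η) :
    IsOrbitWindow f⁻¹ (reverseSeq x) (-i) R η := fun j hj => by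
  have := h (-j) (by simpa using hj)
  simpa [reverseSeq, add_comm] using this

theorem isOrbitWindow_shiftPow {i : ℤ} {R : ℕ} {η : ℝ} (h : IsOrbitWindow f x i R η) :
    IsOrbitWindow f (shiftPow i x) 0 R η := fun j hj => by
  simpa [shiftPow, add_comm] using h j hj

theorem dist_zpow_le (hL : ∀ p q, dist (f p) (f q) ≤ L * dist p q)
    (hL' : ∀ p q, dist (f⁻¹ p) (f⁻¹ q) ≤ L * dist p q) (h1 : 1 ≤ L) (i : ℤ) (p q : M) :
    dist ((f ^ i) p) ((f ^ i) q) ≤ L ^ i.natAbs * dist p q := by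
  obtain ⟨n, rfl | rfl⟩ := i.eq_nat_or_neg
  · simpa using dist_pow_le hL h1 n p q
  · rw [zpow_neg_natCast_apply, zpow_neg_natCast_apply]
    simpa using dist_pow_le hL' h1 n p q

/-- Inside the window, the error between two arbitrary times is controlled. -/
theorem IsOrbitWindow.dist_le (hL : ∀ p q, dist (f p) (f q) ≤ L * dist p q)
    (hL' : ∀ p q, dist (f⁻¹ p) (f⁻¹ q) ≤ L * dist p q) (h1 : 1 ≤ L) {i : ℤ} {R : ℕ} {η : ℝ}
    (h : IsOrbitWindow f x i R η) {a b : ℤ} (ha : (a - i).natAbs ≤ R) (hb : (b - i).natAbs ≤ R) :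
    dist ((f ^ (b - a)) (x a)) (x b) ≤ (1 + L ^ (b - a).natAbs) * η := by
  have h2 := h (a - i) ha
  have h3 := h (b - i) hb
  rw [add_sub_cancel] at h2 h3
  have h4 := dist_zpow_le hL hL' h1 (b - a) (x a) ((f ^ (a - i)) (x i))
  rw [← zpow_add_apply, sub_add_sub_cancel] at h4
  have h5 : L ^ (b - a).natAbs * dist (x a) ((f ^ (a - i)) (x i))
      ≤ L ^ (b - a).natAbs * η := by gcongr
  have h6 := dist_triangle_right ((f ^ (b - a)) (x a)) (x b) ((f ^ (b - i)) (x i))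
  linarith

/-- The forward limit follows `x` at positive times around which `x` is close to an orbit: the jumps
in the distant past have been damped, and those in the distant future are contracted
by backward iteration. -/
theorem IsInducing.exists_dist_shPlus_le [CompleteSpace M] (h : IsInducing f B γ c μ m L) :
    ∃ C : ℝ, 0 ≤ C ∧ ∀ (x : ℤ → M) (W i : ℕ) (η : ℝ), BracketsApply f B γ m x → 0 < W →
      IsOrbitWindow f x i ((W + 2) * m) η →
        dist ((f ^ i) (shPlus f B m x)) (x i) ≤ C * ((1 / 2) ^ W + η) := by
  have hL1 := h.one_le
  have hL0 : 0 ≤ L := zero_le_one.trans hL1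
  have hm := h.m_pos
  have hγ := h.bracket.gamma_pos
  have hc := h.bracket.one_le_c
  refine ⟨L ^ m * ((1 + c) * (2 * γ + 2 * (1 + L ^ m)) + γ) + (1 + L ^ m), by positivity, ?_⟩
  intro x W i η hx hW hw
  have hη : 0 ≤ η := by simpa using hw 0 (by simp)
  set N := i / m with hN
  set s := i % m with hs
  have his : m * N + s = i := Nat.div_add_mod i m
  have hsm : s < m := Nat.mod_lt i hm
  set b := (1 + L ^ m) * η with hb
  have hb0 : 0 ≤ b := by positivity
  have hstep : ∀ n, N ≤ n + W → n ≤ N + W → stepError f m x n ≤ b := by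
    intro n h1 h2
    have e1 : N * m ≤ n * m + W * m := by rw [← add_mul]; exact Nat.mul_le_mul_right m h1
    have e2 : n * m ≤ N * m + W * m := by rw [← add_mul]; exact Nat.mul_le_mul_right m h2
    have e3 : (n + 1) * m = n * m + m := by ring
    have e4 : (W + 2) * m = W * m + 2 * m := by ring
    have e5 : m * N = N * m := mul_comm _ _
    have key := hw.dist_le h.lip h.lip_inv hL1 (a := ((n * m : ℕ) : ℤ))
      (b := (((n + 1) * m : ℕ) : ℤ)) (by omega) (by omega)
    have e6 : (((n + 1) * m : ℕ) : ℤ) - ((n * m : ℕ) : ℤ) = (m : ℤ) := by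
      rw [e3]; push_cast; ring
    rw [e6, zpow_natCast, Int.natAbs_natCast] at key
    exact key
  set α := 2 * γ * (1 / 2) ^ W + 2 * b with hα
  have hα0 : 0 ≤ α := by positivity
  have hjump : ∀ n, N ≤ n + 1 → n < N + W → jump f B m x n ≤ α := by
    intro n h1 h2
    rcases le_total W N with hWN | hNW
    · obtain ⟨k, rfl⟩ := Nat.exists_eq_add_of_le (show N - W ≤ n by omega)
      have h3 := h.jump_add_le hx (b := b) (N - W) k fun i hi => hstep _ (by omega) (by omega)
      have h4 : (1 / 2 : ℝ) ^ (k + 1) ≤ (1 / 2) ^ W :=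
        pow_le_pow_of_le_one (by norm_num) (by norm_num) (by omega)
      have h5 : (1 / 2 : ℝ) ^ k * jump f B m x (N - W) ≤ (1 / 2) ^ k * γ := by
        have := hx (N - W)
        exact mul_le_mul_of_nonneg_left this (by positivity)
      have h6 : 0 ≤ (1 / 2 : ℝ) ^ k * b := by positivity
      have h7 : (1 / 2 : ℝ) ^ (k + 1) * γ ≤ (1 / 2) ^ W * γ := by gcongr
      rw [pow_succ] at h7
      linarith
    · have h3 := h.jump_add_le hx (b := b) 0 n fun i hi => hstep _ (by omega) (by omega)
      have h4 : jump f B m x 0 ≤ b := by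
        rw [jump_zero]; exact hstep 0 (by omega) (by omega)
      have h5 : (1 / 2 : ℝ) ^ n * jump f B m x 0 ≤ (1 / 2) ^ n * b := by gcongr
      have h6 : 0 ≤ (1 / 2 : ℝ) ^ n * b := by positivity
      have h7 : 0 ≤ γ * (1 / 2 : ℝ) ^ W := by positivity
      rw [zero_add] at h3
      linarith
  have h1 : dist ((f ^ (N * m)) (shPlus f B m x)) (qSeq f B m x N) ≤ α + γ * (1 / 2) ^ W :=
    h.dist_shPlus_qSeq_le hx hα0 N W (fun i hi => hjump _ (by omega) (by omega)) fun i => hx _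
  have h2 : dist (qSeq f B m x N) (x ((N * m : ℕ) : ℤ)) ≤ c * α := by
    rcases Nat.eq_zero_or_pos N with h0 | h0
    · rw [h0]
      simp only [qSeq, zero_mul, Nat.cast_zero, dist_self]
      positivity
    · obtain ⟨k, hk⟩ := Nat.exists_eq_succ_of_ne_zero h0.ne'
      rw [hk]
      refine (h.dist_qSeq_succ_le hx k).trans ?_
      have := hjump k (by omega) (by omega)
      gcongr
  set E := (1 + c) * α + γ * (1 / 2) ^ W with hE
  have hE0 : 0 ≤ E := by positivity
  have h3 : dist ((f ^ (N * m)) (shPlus f B m x)) (x ((N * m : ℕ) : ℤ)) ≤ E := by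
    have := dist_triangle ((f ^ (N * m)) (shPlus f B m x)) (qSeq f B m x N)
      (x ((N * m : ℕ) : ℤ))
    linarith
  have hi : i = s + N * m := by rw [← his]; ring
  have hLs : L ^ s ≤ L ^ m := pow_le_pow_right₀ hL1 hsm.le
  have h4 := dist_pow_le h.lip hL1 s ((f ^ (N * m)) (shPlus f B m x)) (x ((N * m : ℕ) : ℤ))
  rw [← pow_add_apply, ← hi] at h4
  have e4 : (W + 2) * m = W * m + 2 * m := by ring
  have h5 := hw.dist_le h.lip h.lip_inv hL1 (a := ((N * m : ℕ) : ℤ)) (b := (i : ℤ))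
    (by omega) (by omega)
  have e6 : (i : ℤ) - ((N * m : ℕ) : ℤ) = (s : ℤ) := by omega
  rw [e6, zpow_natCast, Int.natAbs_natCast] at h5
  have h6 := dist_triangle ((f ^ i) (shPlus f B m x)) ((f ^ s) (x ((N * m : ℕ) : ℤ))) (x i)
  have h7 : L ^ s * dist ((f ^ (N * m)) (shPlus f B m x)) (x ((N * m : ℕ) : ℤ)) ≤ L ^ m * E := by
    gcongr
  have h8 : (1 + L ^ s) * η ≤ (1 + L ^ m) * η := by gcongr
  set t : ℝ := (1 / 2) ^ W with ht
  have ht0 : 0 ≤ t := by positivity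
  have hLm : 0 ≤ L ^ m := by positivity
  have h9 : E ≤ ((1 + c) * (2 * γ + 2 * (1 + L ^ m)) + γ) * (t + η) := by
    have p1 : 0 ≤ (1 + c) * (2 * γ * η + 2 * (1 + L ^ m) * t) + γ * η := by positivity
    rw [hE, hα, hb]
    linarith
  have h10 : L ^ m * E ≤ L ^ m * (((1 + c) * (2 * γ + 2 * (1 + L ^ m)) + γ) * (t + η)) := by
    gcongr
  have h11 : 0 ≤ (1 + L ^ m) * t := by positivity
  linarith

/-- The window condition at a nonnegative time `i` implies that the point of the induced map follows
`x` at the time `i`. For large `i`, the induced point and the forward limit are asymptotic; for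
small `i`, the window contains the time `0`, where both limits are close to `x_0`. -/
theorem IsInducing.exists_window_of_nonneg [CompleteSpace M] (h : IsInducing f B γ c μ m L)
    {ε : ℝ} (hε : 0 < ε) : ∃ (R : ℕ) (η : ℝ), 0 < η ∧ ∀ x : ℤ → M, AppliesAt f B γ m x → ∀ i : ℕ,
      IsOrbitWindow f x i R η → dist ((f ^ i) (inducedMap f B m x)) (x i) ≤ ε := by
  have hL1 := h.one_le
  have hL0 : 0 ≤ L := zero_le_one.trans hL1
  have hγ := h.bracket.gamma_pos
  have hc := h.bracket.one_le_c
  have hμ0 := h.bracket.mu_pos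
  have hμ1 := h.bracket.mu_lt_one
  obtain ⟨C, hC, hCf⟩ := h.exists_dist_shPlus_le
  obtain ⟨C', hC', hCb⟩ := h.flip.exists_dist_shPlus_le
  -- The accuracy required of the limits, at the time `i` and at the time `0`.
  set e := ε / (4 * c) with he
  have he0 : 0 < e := by positivity
  have hce : c * e = ε / 4 := by rw [he]; field_simp
  have hee : e ≤ ε / 4 := by rw [← hce]; exact le_mul_of_one_le_left he0.le hc
  obtain ⟨K, hK⟩ : ∃ K : ℕ, c * μ ^ K * γ ≤ ε / 2 := by
    have : Tendsto (fun n : ℕ => c * μ ^ n * γ) atTop (𝓝 0) := by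
      simpa using ((tendsto_pow_atTop_nhds_zero_of_lt_one hμ0.le hμ1).const_mul c).mul_const γ
    obtain ⟨K, hK⟩ := (this.eventually (gt_mem_nhds (half_pos hε))).exists
    exact ⟨K, hK.le⟩
  obtain ⟨W, hW0, hW⟩ : ∃ W : ℕ, 0 < W ∧ (C + C') * (1 / 2 : ℝ) ^ W ≤ e / 2 := by
    have : Tendsto (fun n : ℕ => (C + C') * (1 / 2 : ℝ) ^ n) atTop (𝓝 0) := by
      simpa using (tendsto_pow_atTop_nhds_zero_of_lt_one (r := (1 / 2 : ℝ)) (by norm_num)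
        (by norm_num)).const_mul (C + C')
    obtain ⟨W, hW, hW0⟩ := ((this.eventually (gt_mem_nhds (half_pos he0))).and
      (eventually_gt_atTop 0)).exists
    exact ⟨W, hW0, hW.le⟩
  set R := (W + 2) * m with hR
  obtain ⟨η, hη0, hη⟩ : ∃ η : ℝ, 0 < η ∧ (C + C') * ((1 + L ^ R) * η) ≤ e / 2 := by
    refine ⟨e / 2 / ((C + C') * (1 + L ^ R) + 1), by positivity, ?_⟩
    rw [← mul_assoc, mul_div_assoc', div_le_iff₀ (by positivity)]
    nlinarith
  have hη1 : η ≤ (1 + L ^ R) * η :=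
    le_mul_of_one_le_left hη0.le (le_add_of_nonneg_right (by positivity))
  have hsmall : ∀ D η', 0 ≤ D → D ≤ C + C' → 0 ≤ η' → η' ≤ (1 + L ^ R) * η →
      D * ((1 / 2) ^ W + η') ≤ e := by
    intro D η' h0 h1 h2 h3
    calc D * ((1 / 2) ^ W + η') ≤ (C + C') * ((1 / 2) ^ W + (1 + L ^ R) * η) := by gcongr
      _ ≤ e := by rw [mul_add]; linarith
  refine ⟨R + K, η, hη0, fun x hx i hw => ?_⟩
  have h1 : dist ((f ^ i) (shPlus f B m x)) (x i) ≤ e :=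
    (hCf x W i η hx.1 hW0 (hw.mono (by omega) le_rfl)).trans
      (hsmall C η hC (by linarith) hη0.le hη1)
  have h2 := h.bracket.forward _ _ hx.2.2 i
  change dist ((f ^ i) (inducedMap f B m x)) _ ≤ _ at h2
  have h3 : c * μ ^ i * dist (shMinus f B m x) (shPlus f B m x) ≤ ε / 2 := by
    rcases le_total K i with hKi | hiK
    · refine le_trans ?_ hK
      have : μ ^ i ≤ μ ^ K := pow_le_pow_of_le_one hμ0.le hμ1.le hKi
      have := hx.2.2
      gcongr
    · have hw0 : IsOrbitWindow f x 0 R ((1 + L ^ R) * η) := by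
        intro j hj
        have := hw.dist_le h.lip h.lip_inv hL1 (a := 0) (b := j) (by omega) (by omega)
        rw [sub_zero] at this
        rw [zero_add, dist_comm]
        refine this.trans ?_
        have : L ^ j.natAbs ≤ L ^ R := pow_le_pow_right₀ hL1 hj
        gcongr
      have h4 : dist (shPlus f B m x) (x 0) ≤ e := by
        have := (hCf x W 0 _ hx.1 hW0 (by simpa using hw0)).trans
          (hsmall C _ hC (by linarith) (by positivity) le_rfl)
        simpa using this
      have h5 : dist (shMinus f B m x) (x 0) ≤ e := by
        have := (hCb (reverseSeq x) W 0 _ hx.2.1 hW0 (by simpa using hw0.reverse)).trans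
          (hsmall C' _ hC' (by linarith) (by positivity) le_rfl)
        rw [shMinus]
        simpa [reverseSeq] using this
      have h6 : dist (shMinus f B m x) (shPlus f B m x) ≤ e + e :=
        (dist_triangle_right _ _ (x 0)).trans (add_le_add h5 h4)
      have h7 : μ ^ i ≤ 1 := pow_le_one₀ hμ0.le hμ1.le
      calc c * μ ^ i * dist (shMinus f B m x) (shPlus f B m x) ≤ c * 1 * (e + e) := by gcongr
        _ = ε / 2 := by rw [mul_one, mul_add, hce]; ring
  have := dist_triangle ((f ^ i) (inducedMap f B m x)) ((f ^ i) (shPlus f B m x)) (x i)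
  linarith

theorem IsInducing.exists_window [CompleteSpace M] (h : IsInducing f B γ c μ m L)
    {ε : ℝ} (hε : 0 < ε) : ∃ (R : ℕ) (η : ℝ), 0 < η ∧ ∀ x : ℤ → M, AppliesAt f B γ m x → ∀ i : ℤ,
      IsOrbitWindow f x i R η → dist ((f ^ i) (inducedMap f B m x)) (x i) ≤ ε := by
  obtain ⟨R, η, hη, hf⟩ := h.exists_window_of_nonneg hε
  obtain ⟨R', η', hη', hb⟩ := h.flip.exists_window_of_nonneg hε
  refine ⟨max R R', min η η', lt_min hη hη', fun x hx i hw => ?_⟩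
  obtain ⟨n, rfl | rfl⟩ := i.eq_nat_or_neg
  · simpa using hf x hx n (hw.mono (le_max_left _ _) (min_le_left _ _))
  · have hw' := (hw.mono (le_max_right _ _) (min_le_right _ _)).reverse
    rw [neg_neg] at hw'
    have := hb (reverseSeq x) hx.reverse n hw'
    rw [inducedMap_inv_reverseSeq] at this
    rwa [zpow_neg_natCast_apply]

/-- A local form of shadowing, which implies both the shadowing property and self-tuning: on a
neighbourhood of the time `i` where `x` is close to an orbit, the induced map almost commutes with
the shift. -/
theorem IsInducing.exists_window_shift [CompleteSpace M] (h : IsInducing f B γ c μ m L) {δ : ℝ}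
    (hδ : ConstructionApplies f B γ m δ) {ε : ℝ} (hε : 0 < ε) :
    ∃ (R : ℕ) (η : ℝ), 0 < η ∧ ∀ x ∈ pseudoOrbits f δ, ∀ i : ℤ, IsOrbitWindow f x i R η →
      dist ((f ^ i) (inducedMap f B m x)) (inducedMap f B m (shiftPow i x)) ≤ ε := by
  obtain ⟨R, η, hη, hw⟩ := h.exists_window (half_pos hε)
  refine ⟨R, η, hη, fun x hx i hi => ?_⟩
  have h1 := hw x (hδ x hx) i hi
  have h2 := hw (shiftPow i x) (hδ _ (shiftPow_mem_pseudoOrbits hx i)) 0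
    (isOrbitWindow_shiftPow hi)
  have e : shiftPow i x 0 = x i := by simp [shiftPow]
  rw [e, zpow_zero, Homeomorph.one_apply] at h2
  have := dist_triangle_right ((f ^ i) (inducedMap f B m x)) (inducedMap f B m (shiftPow i x)) (x i)
  linarith

theorem isOrbitWindow_of_mem_pseudoOrbits (hL : ∀ p q, dist (f p) (f q) ≤ L * dist p q)
    (hL' : ∀ p q, dist (f⁻¹ p) (f⁻¹ q) ≤ L * dist p q) (h1 : 1 ≤ L) {δ : ℝ} (hδ : 0 ≤ δ)
    (hx : x ∈ pseudoOrbits f δ) (i : ℤ) (R : ℕ) :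
    IsOrbitWindow f x i R ((∑ k ∈ Finset.range R, L ^ k) * (L * δ)) := by
  have hL0 : 0 ≤ L := zero_le_one.trans h1
  have hmono : ∀ n ≤ R, (∑ k ∈ Finset.range n, L ^ k) ≤ ∑ k ∈ Finset.range R, L ^ k :=
    fun n hn => Finset.sum_le_sum_of_subset_of_nonneg (Finset.range_subset_range.2 hn)
      fun k _ _ => by positivity
  intro j hj
  rw [dist_comm]
  obtain ⟨n, rfl | rfl⟩ := j.eq_nat_or_neg
  · have hn : n ≤ R := by simpa using hj
    rw [zpow_natCast]
    refine (dist_pow_apply_le hL hL0 hx i n).trans ?_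
    have h2 := hmono n hn
    have h3 : δ ≤ L * δ := le_mul_of_one_le_left hδ h1
    gcongr
  · have hn : n ≤ R := by simpa using hj
    rw [zpow_neg_natCast_apply]
    have h2 := dist_pow_apply_le hL' hL0 (reverseSeq_mem_pseudoOrbits hL' hL0 hx) (-i) n
    have e1 : reverseSeq x (-i) = x i := by simp [reverseSeq]
    have e2 : reverseSeq x (-i + n) = x (i + -n) := by
      rw [reverseSeq]; congr 1; ring
    rw [e1, e2] at h2
    refine h2.trans ?_
    have h3 := hmono n hn
    gcongr

theorem IsInducing.isShadowingMap [CompleteSpace M] (h : IsInducing f B γ c μ m L) {δ : ℝ}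
    (hδ0 : 0 < δ) (hδ : ConstructionApplies f B γ m δ) :
    IsShadowingMap f δ (inducedMap f B m) where
  isPseudoOrbitMap := h.isPseudoOrbitMap hδ
  shadowing ε hε := by
    have hL0 : 0 ≤ L := zero_le_one.trans h.one_le
    obtain ⟨R, η, hη, hw⟩ := h.exists_window_shift hδ hε
    set A := (∑ k ∈ Finset.range R, L ^ k) * L with hA
    have hA0 : 0 ≤ A := by positivity
    have hpos : 0 < min δ (η / (A + 1)) := lt_min hδ0 (by positivity)
    refine ⟨_, hpos, min_le_left _ _, fun x hx i => ?_⟩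
    refine hw x (pseudoOrbits_mono f (min_le_left _ _) hx) i ?_
    refine (isOrbitWindow_of_mem_pseudoOrbits h.lip h.lip_inv h.one_le hpos.le hx i R).mono
      le_rfl ?_
    rw [← mul_assoc, ← hA]
    calc A * min δ (η / (A + 1)) ≤ (A + 1) * (η / (A + 1)) :=
          mul_le_mul (by linarith) (min_le_right _ _) hpos.le (by linarith)
      _ = η := by field_simp

theorem summable_seqDist [CompactSpace M] {lam : ℝ} (h0 : 0 < lam) (h1 : lam < 1) (x y : ℤ → M) :
    Summable fun i : ℤ => lam ^ i.natAbs * dist (x i) (y i) := by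
  have hs : Summable fun i : ℤ => lam ^ i.natAbs := by
    refine Summable.of_nat_of_neg ?_ ?_ <;>
    simpa using summable_geometric_of_lt_one h0.le h1
  refine Summable.of_nonneg_of_le (fun i => by positivity) (fun i => ?_)
    (hs.mul_right (Metric.diam (univ : Set M)))
  have := Metric.dist_le_diam_of_mem (isCompact_univ (X := M)).isBounded (mem_univ (x i))
    (mem_univ (y i))
  gcongr

theorem isOrbitWindow_of_seqDist_lt [CompactSpace M] {lam : ℝ} (h0 : 0 < lam) (h1 : lam < 1)
    {i : ℤ} {R : ℕ} {η : ℝ}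
    (h : seqDist lam (shiftPow i x) (orbitMap f (x i)) < lam ^ R * η) :
    IsOrbitWindow f x i R η := by
  intro j hj
  have hs := summable_seqDist h0 h1 (shiftPow i x) (orbitMap f (x i))
  have h2 := hs.le_tsum j fun k _ => by positivity
  have h3 : lam ^ R ≤ lam ^ j.natAbs := pow_le_pow_of_le_one h0.le h1.le hj
  have h4 : lam ^ R * dist (x (i + j)) ((f ^ j) (x i)) ≤ lam ^ R * η := by
    refine le_trans ?_ (h2.trans h.le)
    rw [shiftPow, orbitMap, add_comm j i]
    gcongr
  exact le_of_mul_le_mul_left h4 (by positivity)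

theorem IsInducing.hasSelfTuning [CompactSpace M] (h : IsInducing f B γ c μ m L) {δ : ℝ}
    (hδ : ConstructionApplies f B γ m δ) {lam : ℝ} (h0 : 0 < lam) (h1 : lam < 1) :
    HasSelfTuning lam f δ (inducedMap f B m) := by
  intro ε hε
  obtain ⟨R, η, hη, hw⟩ := h.exists_window_shift hδ hε
  exact ⟨lam ^ R * η, by positivity, fun x hx i hi =>
    hw x hx i (isOrbitWindow_of_seqDist_lt h0 h1 hi)⟩

end Shadowing

/-! ### North-south dynamics: scales and hyperbolicity of the geodesic bracket -/

section NorthSouthBracket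

open Filter Set

variable {M : Type*} [MetricSpace M] {f : M ≃ₜ M} {N S : M} {r μ : ℝ}

theorem pow_apply_of_fixed {p : M} (h : f p = p) (n : ℕ) : (f ^ n) p = p := by
  induction n with
  | zero => simp
  | succ n ih => rw [pow_succ', Homeomorph.mul_apply, ih, h]

theorem inv_apply_of_fixed {p : M} (h : f p = p) : f⁻¹ p = p := by
  have := inv_pow_apply_pow_apply f 1 p
  rwa [pow_one, pow_one, h] at this

theorem IsNorthSouth.inv (hf : IsNorthSouth f N S) : IsNorthSouth f⁻¹ S N where
  ne := hf.ne.symm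
  fixed_north := inv_apply_of_fixed hf.fixed_south
  fixed_south := inv_apply_of_fixed hf.fixed_north
  tendsto_south p h1 h2 := hf.tendsto_north p h2 h1
  tendsto_north p h1 h2 := by simpa only [inv_inv] using hf.tendsto_south p h2 h1

theorem IsLocallyContracting.inv (hc : IsLocallyContracting f N S r μ) :
    IsLocallyContracting f⁻¹ S N r μ where
  r_pos := hc.r_pos
  mu_pos := hc.mu_pos
  mu_lt_one := hc.mu_lt_one
  south := hc.north
  north := by simpa only [inv_inv] using hc.south
  disjoint := hc.disjoint.symm

theorem IsLocallyContracting.pow_mem_ball (hc : IsLocallyContracting f N S r μ)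
    (hf : IsNorthSouth f N S) {s : ℝ} (hs : s ≤ r) {p : M} (hp : p ∈ Metric.ball S s) (n : ℕ) :
    (f ^ n) p ∈ Metric.ball S s := by
  have h := hc.south p (Metric.ball_subset_ball hs hp) S (Metric.mem_ball_self hc.r_pos) n
  rw [pow_apply_of_fixed hf.fixed_south] at h
  exact (h.trans (mul_le_of_le_one_left dist_nonneg
    (pow_le_one₀ hc.mu_pos.le hc.mu_lt_one.le))).trans_lt hp

/-- Points away from both poles enter a given neighbourhood of `S` after a uniform time. -/
theorem IsNorthSouth.exists_uniform_time [CompactSpace M] (hf : IsNorthSouth f N S)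
    (hc : IsLocallyContracting f N S r μ) {s : ℝ} (hs0 : 0 < s) (hs : s ≤ r) :
    ∃ u : ℕ, ∀ p : M, s ≤ dist p N → s ≤ dist p S → ∀ n, u ≤ n →
      (f ^ n) p ∈ Metric.ball S s := by
  have hK : IsCompact {p : M | s ≤ dist p N ∧ s ≤ dist p S} :=
    ((isClosed_le continuous_const (continuous_id.dist continuous_const)).inter
      (isClosed_le continuous_const (continuous_id.dist continuous_const))).isCompact
  obtain ⟨u, hu⟩ := hK.elim_directed_cover (fun n : ℕ => (f ^ n) ⁻¹' Metric.ball S s)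
    (fun n => Metric.isOpen_ball.preimage (f ^ n).continuous) (fun p hp => by
      have hpN : p ≠ N := dist_pos.1 (hs0.trans_le hp.1)
      have hpS : p ≠ S := dist_pos.1 (hs0.trans_le hp.2)
      obtain ⟨n, hn⟩ := ((hf.tendsto_south p hpN hpS).eventually
        (Metric.ball_mem_nhds S hs0)).exists
      exact mem_iUnion.2 ⟨n, hn⟩)
    (directed_of_isDirected_le fun a b hab p hp => by
      obtain ⟨k, rfl⟩ := Nat.exists_eq_add_of_le hab
      rw [mem_preimage, add_comm, pow_add_apply]
      exact hc.pow_mem_ball hf hs hp k)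
  refine ⟨u, fun p h1 h2 n hn => ?_⟩
  obtain ⟨k, rfl⟩ := Nat.exists_eq_add_of_le hn
  rw [add_comm, pow_add_apply]
  exact hc.pow_mem_ball hf hs (hu ⟨h1, h2⟩) k

theorem exists_isBracketScale [CompactSpace M] (hM : HasAlmostGeodesics M)
    (hf : IsNorthSouth f N S) (hc : IsLocallyContracting f N S r μ) (φ : C(M, Icc (0 : ℝ) 1))
    {ρ : ℝ} (hρ : 0 < ρ) (hexp : ExpInjective M ρ) :
    ∃ (δ : ℝ) (u : ℕ), IsBracketScale f N S r ρ φ δ u := by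
  have hr := hc.r_pos
  obtain ⟨u, hu⟩ := hf.exists_uniform_time hc (half_pos hr) (by linarith)
  obtain ⟨v, hv⟩ := hf.inv.exists_uniform_time hc.inv (half_pos hr) (by linarith)
  set δ := min (r / 4) (ρ / 2) with hδ
  have hδr : δ ≤ r / 4 := min_le_left _ _
  have hδρ : δ ≤ ρ / 2 := min_le_right _ _
  have hin : ∀ p : M, r / 2 ≤ dist p N → r / 2 ≤ dist p S → ∀ i : ℤ,
      ((max (max u v) 1 : ℕ) : ℤ) ≤ |i| →
        (f ^ i) p ∈ Metric.ball N (r / 2) ∪ Metric.ball S (r / 2) := by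
    intro p h1 h2 i hi
    obtain ⟨n, rfl | rfl⟩ := i.eq_nat_or_neg
    · rw [Nat.abs_cast] at hi
      rw [zpow_natCast]
      exact Or.inr (hu p h1 h2 n (by omega))
    · rw [abs_neg, Nat.abs_cast] at hi
      rw [zpow_neg_natCast_apply]
      exact Or.inl (hv p h2 h1 n (by omega))
  have hfar : ∀ p ∈ middleRegion N S r δ, ∀ z : M, dist p z < δ →
      r / 2 ≤ dist z N ∧ r / 2 ≤ dist z S := by
    intro p hp z hz
    have h1 := dist_triangle p z N
    have h2 := dist_triangle p z S
    have h3 := hp.1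
    have h4 := hp.2
    constructor <;> linarith
  have hδ0 : 0 < δ := lt_min (by linarith) (by linarith)
  refine ⟨δ, max (max u v) 1, hδ0, by linarith, by linarith, ?_, le_max_right _ _, ?_⟩
  · intro p hp q _ hpq g hg t ht
    have hmin := hg.isMinimizing hM hexp (by linarith)
    have hd : dist p (g t) < δ := by
      have := hmin.dist_eq 0 (by simp) t ht
      rw [hmin.zero, zero_sub, abs_neg, abs_of_nonneg ht.1] at this
      rw [this]
      exact (mul_le_of_le_one_left dist_nonneg ht.2).trans_lt hpq
    obtain ⟨h1, h2⟩ := hfar p hp _ hd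
    rintro (h | h)
    · exact absurd (Metric.mem_ball.1 h) h1.not_gt
    · exact absurd (Metric.mem_ball.1 h) h2.not_gt
  · intro p hp q _ hpq i hi
    have hb : dist p (geodesicBracket ρ φ p q) < δ := by
      rw [dist_left_geodesicBracket hM hexp φ (by linarith)]
      exact (mul_le_of_le_one_left dist_nonneg (φ p).2.2).trans_lt hpq
    obtain ⟨a1, a2⟩ := hfar p hp p (by rwa [dist_self])
    obtain ⟨b1, b2⟩ := hfar p hp q hpq
    obtain ⟨c1, c2⟩ := hfar p hp _ hb
    exact ⟨hin _ a1 a2 i hi, hin _ b1 b2 i hi, hin _ c1 c2 i hi⟩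

/-- Two points outside the ball `B_{r/2}(N)`, which is backward invariant, and whose images at the
time `u` are in one of the two balls, are both near `S` at the time `u`, and are contracted from
then on. -/
theorem IsLocallyContracting.dist_pow_le_of_enters (hc : IsLocallyContracting f N S r μ)
    (hf : IsNorthSouth f N S) {L : ℝ} (hL : ∀ p q, dist (f p) (f q) ≤ L * dist p q) (hL1 : 1 ≤ L)
    {u : ℕ} {p q : M} (hp : p ∉ Metric.ball N (r / 2)) (hq : q ∉ Metric.ball N (r / 2))
    (hpu : (f ^ u) p ∈ Metric.ball N (r / 2) ∪ Metric.ball S (r / 2))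
    (hqu : (f ^ u) q ∈ Metric.ball N (r / 2) ∪ Metric.ball S (r / 2)) (n : ℕ) :
    dist ((f ^ n) p) ((f ^ n) q) ≤ L ^ u / μ ^ u * μ ^ n * dist p q := by
  have hr := hc.r_pos
  have hμ0 := hc.mu_pos
  have hL0 : 0 ≤ L := zero_le_one.trans hL1
  have hS : ∀ z : M, z ∉ Metric.ball N (r / 2) →
      (f ^ u) z ∈ Metric.ball N (r / 2) ∪ Metric.ball S (r / 2) → (f ^ u) z ∈ Metric.ball S r := by
    rintro z hz (h | h)
    · have := hc.inv.pow_mem_ball hf.inv (by linarith) h u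
      rw [inv_pow_apply_pow_apply] at this
      exact absurd this hz
    · exact Metric.ball_subset_ball (by linarith) h
  rcases le_total n u with hn | hn
  · refine (dist_pow_le hL hL1 n p q).trans ?_
    have h1 : μ ^ u ≤ μ ^ n := pow_le_pow_of_le_one hμ0.le hc.mu_lt_one.le hn
    have h2 : L ^ n ≤ L ^ u := pow_le_pow_right₀ hL1 hn
    have h3 : L ^ n ≤ L ^ u / μ ^ u * μ ^ n := by
      rw [div_mul_eq_mul_div, le_div_iff₀ (by positivity)]
      gcongr
    gcongr
  · obtain ⟨k, rfl⟩ := Nat.exists_eq_add_of_le hn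
    have h1 := hc.south _ (hS p hp hpu) _ (hS q hq hqu) k
    rw [← pow_add_apply, ← pow_add_apply, add_comm k u] at h1
    have h2 := dist_pow_le hL hL1 u p q
    calc dist ((f ^ (u + k)) p) ((f ^ (u + k)) q)
        ≤ μ ^ k * (L ^ u * dist p q) := h1.trans (by gcongr)
      _ = L ^ u / μ ^ u * μ ^ (u + k) * dist p q := by
        rw [pow_add]; field_simp

theorem isHyperbolicBracket_geodesicBracket [CompactSpace M] (hM : HasAlmostGeodesics M)
    (hf : IsNorthSouth f N S) (hc : IsLocallyContracting f N S r μ) {L : ℝ}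
    (hL : ∀ p q, dist (f p) (f q) ≤ L * dist p q)
    (hL' : ∀ p q, dist (f⁻¹ p) (f⁻¹ q) ≤ L * dist p q) (hL1 : 1 ≤ L) {φ : C(M, Icc (0 : ℝ) 1)}
    (hφN : ∀ p ∈ Metric.ball N r, (φ p : ℝ) = 1) (hφS : ∀ p ∈ Metric.ball S r, (φ p : ℝ) = 0)
    {ρ : ℝ} (hexp : ExpInjective M ρ) {δ γ : ℝ} {u : ℕ} (hs : IsBracketScale f N S r ρ φ δ u)
    (hγ0 : 0 < γ) (hγ : γ < δ) :
    IsHyperbolicBracket f (geodesicBracket ρ φ) γ (L ^ u / μ ^ u) μ := by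
  have hμ0 := hc.mu_pos
  have hμ1 := hc.mu_lt_one
  have hγρ : γ < ρ := hγ.trans hs.delta_lt_rho
  have hc1 : 1 ≤ L ^ u / μ ^ u := by
    rw [one_le_div (by positivity)]
    exact (pow_le_one₀ hμ0.le hμ1.le).trans (one_le_pow₀ hL1)
  -- Two `γ`-close points are both in the middle region, or both close to the same pole.
  have cases : ∀ p q : M, dist p q ≤ γ →
      (p ∈ middleRegion N S r δ ∧ q ∈ middleRegion N S r δ) ∨
      (p ∈ Metric.ball N r ∧ q ∈ Metric.ball N r) ∨
      (p ∈ Metric.ball S r ∧ q ∈ Metric.ball S r) := by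
    intro p q hpq
    have hδ := hs.delta_pos
    have near : ∀ x y z : M, dist x y ≤ γ → dist x z ≤ r - δ →
        x ∈ Metric.ball z r ∧ y ∈ Metric.ball z r := by
      intro x y z hxy hx
      have := dist_triangle_left y z x
      exact ⟨by rw [Metric.mem_ball]; linarith, by rw [Metric.mem_ball]; linarith⟩
    have hqp : dist q p ≤ γ := by rwa [dist_comm]
    by_cases h1 : dist p N ≤ r - δ
    · exact Or.inr (Or.inl (near p q N hpq h1))
    by_cases h2 : dist p S ≤ r - δ
    · exact Or.inr (Or.inr (near p q S hpq h2))
    by_cases h3 : dist q N ≤ r - δ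
    · exact Or.inr (Or.inl (near q p N hqp h3).symm)
    by_cases h4 : dist q S ≤ r - δ
    · exact Or.inr (Or.inr (near q p S hqp h4).symm)
    exact Or.inl ⟨⟨not_le.1 h1, not_le.1 h2⟩, ⟨not_le.1 h3, not_le.1 h4⟩⟩
  have avoid : ∀ p ∈ middleRegion N S r δ, ∀ q ∈ middleRegion N S r δ, dist p q ≤ γ →
      p ∉ Metric.ball N (r / 2) ∪ Metric.ball S (r / 2) ∧
      q ∉ Metric.ball N (r / 2) ∪ Metric.ball S (r / 2) ∧
      geodesicBracket ρ φ p q ∉ Metric.ball N (r / 2) ∪ Metric.ball S (r / 2) := by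
    intro p hp q hq hpq
    obtain ⟨g, hg⟩ := hM.exists_isMinimizing p q
    have h := hs.geodesic_avoids p hp q hq (by linarith) g (hg.isShortGeodesic (by linarith))
    have h0 := h 0 (by simp)
    have h1 := h 1 (by simp)
    have hφ := h (φ p) (φ p).2
    rw [hg.zero] at h0
    rw [hg.one] at h1
    rw [← geodesicBracket_eq hexp φ (by linarith) hg] at hφ
    exact ⟨h0, h1, hφ⟩
  refine ⟨hγ0, hc1, hμ0, hμ1, (continuousOn_geodesicBracket hM hexp φ).mono
    fun z hz => le_trans hz hγρ.le, geodesicBracket_self hM (by linarith) hexp φ, ?_, ?_⟩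
  · intro p q hpq n
    rcases cases p q hpq with ⟨hp, hq⟩ | ⟨hp, hq⟩ | ⟨hp, hq⟩
    · obtain ⟨a1, a2, a3⟩ := avoid p hp q hq hpq
      obtain ⟨e1, e2, e3⟩ := hs.enters p hp q hq (by linarith) u (by simp)
      rw [zpow_natCast] at e2 e3
      refine (hc.dist_pow_le_of_enters hf hL hL1 (fun h => a3 (Or.inl h)) (fun h => a2 (Or.inl h))
        e3 e2 n).trans ?_
      have : dist (geodesicBracket ρ φ p q) q ≤ dist p q := by
        rw [dist_geodesicBracket_right hM hexp φ (by linarith)]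
        exact mul_le_of_le_one_left dist_nonneg (by linarith [(φ p).2.1])
      gcongr
    · rw [geodesicBracket_eq_right hM hexp φ (by linarith) (hφN p hp), dist_self]
      positivity
    · rw [(geodesicBracket_eq_left_iff hM hexp φ (by linarith)).2 (Or.inl (hφS p hp))]
      refine (hc.south p hp q hq n).trans ?_
      have : μ ^ n ≤ L ^ u / μ ^ u * μ ^ n := le_mul_of_one_le_left (by positivity) hc1
      gcongr
  · intro p q hpq n
    rcases cases p q hpq with ⟨hp, hq⟩ | ⟨hp, hq⟩ | ⟨hp, hq⟩
    · obtain ⟨a1, a2, a3⟩ := avoid p hp q hq hpq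
      obtain ⟨e1, e2, e3⟩ := hs.enters p hp q hq (by linarith) (-u) (by simp)
      rw [zpow_neg_natCast_apply] at e1 e3
      refine (hc.inv.dist_pow_le_of_enters hf.inv hL' hL1 (fun h => a3 (Or.inr h))
        (fun h => a1 (Or.inr h)) e3.symm e1.symm n).trans ?_
      have : dist (geodesicBracket ρ φ p q) p ≤ dist p q := by
        rw [dist_comm, dist_left_geodesicBracket hM hexp φ (by linarith)]
        exact mul_le_of_le_one_left dist_nonneg (φ p).2.2
      gcongr
    · rw [geodesicBracket_eq_right hM hexp φ (by linarith) (hφN p hp), dist_comm p q]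
      refine (hc.north q hq p hp n).trans ?_
      have : μ ^ n ≤ L ^ u / μ ^ u * μ ^ n := le_mul_of_one_le_left (by positivity) hc1
      gcongr
    · rw [(geodesicBracket_eq_left_iff hM hexp φ (by linarith)).2 (Or.inl (hφS p hp)), dist_self]
      positivity

end NorthSouthBracket

/-! ### Failure of shift-invariance -/

section ShiftInvariance

open Filter Set

variable {M : Type*} [MetricSpace M]

/-- The sequence which follows the orbit of `p` before the time `a`, and the orbit of `q` from the
time `a` on. -/
def splice (f : M ≃ₜ M) (a : ℤ) (p q : M) : ℤ → M :=
  fun i => if i < a then (f ^ i) p else (f ^ i) q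

/-- The properties of a bracket `[p, q]` which lies on a geodesic from `p` to `q`, at a position
given by a cutoff function `φ` of `p`. -/
structure IsCutoffBracket (B : M → M → M) (γ : ℝ) (φ : M → ℝ) : Prop where
  eq_right : ∀ p q, dist p q ≤ γ → φ p = 1 → B p q = q
  eq_left_iff : ∀ p q, dist p q ≤ γ → (B p q = p ↔ φ p = 0 ∨ p = q)

variable {f : M ≃ₜ M} {B : M → M → M} {γ c μ L : ℝ} {m : ℕ} {φ : M → ℝ} {N S P Q : M} {r : ℝ}

theorem splice_of_lt {a i : ℤ} (h : i < a) : splice f a P Q i = (f ^ i) P := if_pos h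

theorem splice_of_le {a i : ℤ} (h : a ≤ i) : splice f a P Q i = (f ^ i) Q := if_neg h.not_gt

theorem splice_mem_pseudoOrbits {a : ℤ} {δ : ℝ} (hδ : dist ((f ^ a) P) ((f ^ a) Q) ≤ δ) :
    splice f a P Q ∈ pseudoOrbits f δ := by
  have hδ0 : 0 ≤ δ := dist_nonneg.trans hδ
  intro i
  have e : ∀ z : M, f ((f ^ i) z) = (f ^ (i + 1)) z := fun z => (orbitMap_succ f z i).symm
  rcases lt_trichotomy (i + 1) a with h | h | h
  · rw [splice_of_lt h, splice_of_lt (by omega), e, dist_self]; exact hδ0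
  · rw [splice_of_le h.ge, splice_of_lt (by omega), e, h, dist_comm]; exact hδ
  · rw [splice_of_le h.le, splice_of_le (by omega), e, dist_self]; exact hδ0

theorem shiftPow_one_splice :
    shiftPow 1 (splice f 1 P Q) = splice f 0 (f P) (f Q) := by
  have e : ∀ (i : ℤ) (z : M), (f ^ (i + 1)) z = (f ^ i) (f z) := fun i z => by
    rw [zpow_add_apply, zpow_one]
  funext i
  rcases lt_or_ge i 0 with h | h
  · rw [splice_of_lt h, shiftPow, splice_of_lt (by omega), e]
  · rw [splice_of_le h, shiftPow, splice_of_le (by omega), e]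

theorem qSeq_splice_succ (hm : 0 < m) (n : ℕ) : qSeq f B m (splice f 1 P Q) (n + 1) =
    B ((f ^ m) (qSeq f B m (splice f 1 P Q) n)) ((f ^ ((n + 1) * m)) Q) := by
  have : 0 < (n + 1) * m := by positivity
  rw [qSeq, splice_of_le (by omega), zpow_natCast]

theorem bracketsApply_splice (hm : 0 < m) (h : BracketsApply f B γ m (splice f 1 P Q)) (n : ℕ) :
    dist ((f ^ m) (qSeq f B m (splice f 1 P Q) n)) ((f ^ ((n + 1) * m)) Q) ≤ γ := by
  have h1 := h n
  have : 0 < (n + 1) * m := by positivity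
  rwa [splice_of_le (by omega), zpow_natCast] at h1

theorem pSeq_succ_eq {x : ℤ → M} {n : ℕ}
    (h : qSeq f B m x (n + 1) = (f ^ m) (qSeq f B m x n)) :
    pSeq f B m x (n + 1) = pSeq f B m x n := by
  rw [pSeq, h, add_mul, one_mul, pow_add_apply, inv_pow_apply_pow_apply, pSeq]

/-- If `y` follows an orbit after the time `km`, its forward limit is, up to iteration, that of the
sequence which starts from the point `q_k` and follows this orbit. -/
theorem IsInducing.shPlus_eq_of_tail [CompleteSpace M] (h : IsInducing f B γ c μ m L) {y : ℤ → M}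
    (hy : BracketsApply f B γ m y) (k : ℕ) {v : M} (hv : qSeq f B m y k = v)
    (htail : ∀ j, 0 < j → y (((k + j) * m : ℕ) : ℤ) = (f ^ (j * m)) Q) :
    BracketsApply f B γ m (splice f 1 v Q) ∧
      shPlus f B m y = (f⁻¹ ^ (k * m)) (shPlus f B m (splice f 1 v Q)) := by
  have hm := h.m_pos
  have hq : ∀ n, qSeq f B m y (k + n) = qSeq f B m (splice f 1 v Q) n := by
    intro n
    induction n with
    | zero => rw [add_zero, hv, qSeq, splice_of_lt (by norm_num), zpow_zero, Homeomorph.one_apply]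
    | succ n ih =>
      rw [← add_assoc, qSeq, ih, qSeq_splice_succ hm, add_assoc, htail (n + 1) (Nat.succ_pos n)]
  have hb : BracketsApply f B γ m (splice f 1 v Q) := by
    intro n
    have h1 := hy (k + n)
    have : 0 < (n + 1) * m := by positivity
    rw [hq, add_assoc, htail (n + 1) (Nat.succ_pos n)] at h1
    rwa [splice_of_le (by omega), zpow_natCast]
  refine ⟨hb, ?_⟩
  have l1 : Tendsto (fun n => pSeq f B m y (n + k)) atTop (𝓝 (shPlus f B m y)) :=
    (h.tendsto_pSeq hy).comp (tendsto_add_atTop_nat k)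
  have l2 := ((f⁻¹ ^ (k * m)).continuous.tendsto _).comp (h.tendsto_pSeq hb)
  refine tendsto_nhds_unique l1 (l2.congr fun n => ?_)
  rw [Function.comp_apply, pSeq, pSeq, add_comm n k, hq, add_mul, pow_add_apply]

/-- At the time `km`, for large `k`, a sequence which follows the orbit of `Q` is near `S`, where
the bracket is the first projection. Shift-invariance transports this to the time `0`, and identifies
the value of the induced map with a backward limit. -/
theorem IsInducing.inducedMap_eq_backward [CompleteSpace M] (h : IsInducing f B γ c μ m L)
    (hf : IsNorthSouth f N S) (hB : IsCutoffBracket B γ φ) (hφS : ∀ p ∈ Metric.ball S r, φ p = 0)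
    (hγr : γ < r) {x : ℤ → M} (happ : ∀ i, AppliesAt f B γ m (shiftPow i x))
    (hinv : ∀ i, inducedMap f B m (shiftPow i x) = (f ^ i) (inducedMap f B m x))
    (hQN : Q ≠ N) (hQS : Q ≠ S) (hpast : ∀ i : ℤ, i < 0 → x i = (f ^ i) P)
    (hfut : ∀ i : ℤ, 0 < i → x i = (f ^ i) Q) :
    BracketsApply f⁻¹ (flipBracket B) γ m (splice f⁻¹ 1 (B (x 0) Q) P) ∧
      inducedMap f B m x = shPlus f⁻¹ (flipBracket B) m (splice f⁻¹ 1 (B (x 0) Q) P) := by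
  have hm := h.m_pos
  obtain ⟨k, hk0, hk⟩ : ∃ k : ℕ, 0 < k ∧ (f ^ (k * m)) Q ∈ Metric.ball S (r - γ) := by
    have h1 := (hf.tendsto_south Q hQN hQS).eventually (Metric.ball_mem_nhds S (sub_pos.2 hγr))
    obtain ⟨a, ha⟩ := eventually_atTop.1 h1
    exact ⟨a + 1, Nat.succ_pos a, ha _ (by nlinarith)⟩
  set y := shiftPow ((k * m : ℕ) : ℤ) x with hy
  have hplus : shPlus f B m y = (f ^ (k * m)) Q := by
    refine shPlus_eq_of_orbit h.bracket.diag fun j => ?_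
    have : 0 < k * m := by positivity
    rw [hy, shiftPow, hfut _ (by omega), ← Nat.cast_add, zpow_natCast, pow_add_apply]
  have hmem : shMinus f B m y ∈ Metric.ball S r := by
    have h1 := (happ ((k * m : ℕ) : ℤ)).2.2
    rw [← hy, hplus] at h1
    have h2 := dist_triangle (shMinus f B m y) ((f ^ (k * m)) Q) S
    rw [Metric.mem_ball] at hk ⊢
    linarith
  have hmap : inducedMap f B m y = shMinus f B m y :=
    (hB.eq_left_iff _ _ (happ _).2.2).2 (Or.inl (hφS _ hmem))
  have hq : qSeq f⁻¹ (flipBracket B) m (reverseSeq y) k = B (x 0) Q := by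
    obtain ⟨l, rfl⟩ := Nat.exists_eq_succ_of_ne_zero hk0.ne'
    have e : qSeq f⁻¹ (flipBracket B) m (reverseSeq y) l
        = (f⁻¹ ^ (l * m)) ((f ^ ((l + 1) * m)) Q) := by
      refine qSeq_eq_of_orbit h.flip.bracket.diag l fun j hj => ?_
      obtain ⟨d, rfl⟩ := Nat.exists_eq_add_of_le hj
      have e1 : (j + d + 1) * m = j * m + (d + 1) * m := by ring
      have e2 : 0 < (d + 1) * m := by positivity
      rw [reverseSeq, hy, shiftPow, hfut _ (by rw [Nat.succ_eq_add_one]; omega)]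
      have e3 : -((j * m : ℕ) : ℤ) + (((j + d).succ * m : ℕ) : ℤ) = (((d + 1) * m : ℕ) : ℤ) := by
        rw [Nat.succ_eq_add_one]; omega
      rw [e3, zpow_natCast, e1, pow_add_apply, inv_pow_apply_pow_apply]
    have e4 : (l + 1) * m = l * m + m := by ring
    rw [qSeq, e, e4, pow_add_apply f, inv_pow_apply_pow_apply, inv_pow_apply_pow_apply, flipBracket,
      reverseSeq, hy, shiftPow, Nat.succ_eq_add_one, e4, neg_add_cancel]
  obtain ⟨h1, h2⟩ := h.flip.shPlus_eq_of_tail (Q := P) (happ ((k * m : ℕ) : ℤ)).2.1 k hq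
    (fun j hj => by
      have e1 : (k + j) * m = k * m + j * m := by ring
      have e2 : 0 < j * m := by positivity
      have e3 : -(((k + j) * m : ℕ) : ℤ) + ((k * m : ℕ) : ℤ) = -((j * m : ℕ) : ℤ) := by omega
      rw [reverseSeq, shiftPow, e3, hpast _ (by omega), zpow_neg_natCast_apply])
  refine ⟨h1, (f ^ (k * m)).injective ?_⟩
  have h3 := hinv ((k * m : ℕ) : ℤ)
  rw [zpow_natCast] at h3
  rw [← h3, hmap, shMinus, h2, inv_inv]

/-- The counterpart of `inducedMap_eq_backward` at the time `-km`, when the sequence is near `N`,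
where the bracket is the second projection. -/
theorem IsInducing.inducedMap_eq_forward [CompleteSpace M] (h : IsInducing f B γ c μ m L)
    (hf : IsNorthSouth f N S) (hB : IsCutoffBracket B γ φ) (hφN : ∀ p ∈ Metric.ball N r, φ p = 1)
    (hr : 0 < r) {x : ℤ → M} (happ : ∀ i, AppliesAt f B γ m (shiftPow i x))
    (hinv : ∀ i, inducedMap f B m (shiftPow i x) = (f ^ i) (inducedMap f B m x))
    (hPN : P ≠ N) (hPS : P ≠ S) (hpast : ∀ i : ℤ, i < 0 → x i = (f ^ i) P)
    (hfut : ∀ i : ℤ, 0 < i → x i = (f ^ i) Q) :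
    BracketsApply f B γ m (splice f 1 (B P (x 0)) Q) ∧
      inducedMap f B m x = shPlus f B m (splice f 1 (B P (x 0)) Q) := by
  have hm := h.m_pos
  obtain ⟨k, hk0, hk⟩ : ∃ k : ℕ, 0 < k ∧ (f⁻¹ ^ (k * m)) P ∈ Metric.ball N r := by
    have h1 := (hf.tendsto_north P hPN hPS).eventually (Metric.ball_mem_nhds N hr)
    obtain ⟨a, ha⟩ := eventually_atTop.1 h1
    exact ⟨a + 1, Nat.succ_pos a, ha _ (by nlinarith)⟩
  set y := shiftPow (-((k * m : ℕ) : ℤ)) x with hy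
  have hminus : shMinus f B m y = (f⁻¹ ^ (k * m)) P := by
    refine shMinus_eq_of_orbit h.bracket.diag fun j => ?_
    have : 0 < k * m := by positivity
    rw [hy, shiftPow, hpast _ (by omega), ← neg_add, ← Nat.cast_add, zpow_neg_natCast_apply,
      pow_add_apply]
  have hmap : inducedMap f B m y = shPlus f B m y :=
    hB.eq_right _ _ (happ _).2.2 (hφN _ (by rwa [hminus]))
  have hq : qSeq f B m y k = B P (x 0) := by
    obtain ⟨l, rfl⟩ := Nat.exists_eq_succ_of_ne_zero hk0.ne'
    have e : qSeq f B m y l = (f ^ (l * m)) ((f⁻¹ ^ ((l + 1) * m)) P) := by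
      refine qSeq_eq_of_orbit h.bracket.diag l fun j hj => ?_
      obtain ⟨d, rfl⟩ := Nat.exists_eq_add_of_le hj
      have e1 : (j + d + 1) * m = j * m + (d + 1) * m := by ring
      have e2 : 0 < (d + 1) * m := by positivity
      rw [hy, shiftPow, hpast _ (by rw [Nat.succ_eq_add_one]; omega)]
      have e3 : ((j * m : ℕ) : ℤ) + -(((j + d).succ * m : ℕ) : ℤ) = -(((d + 1) * m : ℕ) : ℤ) := by
        rw [Nat.succ_eq_add_one]; omega
      rw [e3, zpow_neg_natCast_apply, e1, pow_add_apply, pow_apply_inv_pow_apply]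
    have e4 : (l + 1) * m = l * m + m := by ring
    rw [qSeq, e, e4, pow_add_apply f⁻¹, pow_apply_inv_pow_apply, pow_apply_inv_pow_apply,
      hy, shiftPow, Nat.succ_eq_add_one, e4, add_neg_cancel]
  obtain ⟨h1, h2⟩ := h.shPlus_eq_of_tail (Q := Q) (happ (-((k * m : ℕ) : ℤ))).1 k hq
    (fun j hj => by
      have e1 : (k + j) * m = k * m + j * m := by ring
      have e2 : 0 < j * m := by positivity
      have e3 : (((k + j) * m : ℕ) : ℤ) + -((k * m : ℕ) : ℤ) = ((j * m : ℕ) : ℤ) := by omega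
      rw [shiftPow, e3, hfut _ (by omega), zpow_natCast])
  refine ⟨h1, (f⁻¹ ^ (k * m)).injective ?_⟩
  have h3 := hinv (-((k * m : ℕ) : ℤ))
  rw [zpow_neg_natCast_apply] at h3
  rw [← h3, hmap, h2]

theorem qSeq_backward_succ (hm : 0 < m) (v : M) (n : ℕ) :
    qSeq f⁻¹ (flipBracket B) m (splice f⁻¹ 1 v P) (n + 1) =
      B ((f⁻¹ ^ ((n + 1) * m)) P)
        ((f⁻¹ ^ m) (qSeq f⁻¹ (flipBracket B) m (splice f⁻¹ 1 v P) n)) :=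
  qSeq_splice_succ hm n

/-- If the cutoff vanishes somewhere on the past of `P`, the backward limit forgets its starting
point. -/
theorem IsInducing.backward_eq_of_cutoff_zero (h : IsInducing f B γ c μ m L)
    (hB : IsCutoffBracket B γ φ) {v : M}
    (hv : BracketsApply f⁻¹ (flipBracket B) γ m (splice f⁻¹ 1 v P)) {n : ℕ}
    (hn : φ ((f⁻¹ ^ ((n + 1) * m)) P) = 0) :
    shPlus f⁻¹ (flipBracket B) m (splice f⁻¹ 1 v P) = P := by
  have hm := h.m_pos
  have hq : ∀ k, qSeq f⁻¹ (flipBracket B) m (splice f⁻¹ 1 v P) (n + 1 + k)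
      = (f⁻¹ ^ ((n + 1 + k) * m)) P := by
    intro k
    induction k with
    | zero =>
      rw [add_zero, qSeq_backward_succ hm]
      refine (hB.eq_left_iff _ _ ?_).2 (Or.inl hn)
      rw [dist_comm]
      exact bracketsApply_splice hm hv n
    | succ k ih =>
      rw [← add_assoc, qSeq_backward_succ hm, ih, ← pow_add_apply, add_comm m, ← Nat.succ_mul,
        h.bracket.diag]
  refine shPlus_eq_of_eventually ?_
  filter_upwards [eventually_ge_atTop (n + 1)] with k hk
  obtain ⟨d, rfl⟩ := Nat.exists_eq_add_of_le hk
  rw [pSeq, hq, ← Homeomorph.mul_apply, inv_pow (f⁻¹), inv_mul_cancel, Homeomorph.one_apply]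

theorem IsInducing.forward_eq_of_cutoff_zero (h : IsInducing f B γ c μ m L)
    (hB : IsCutoffBracket B γ φ) (hP : BracketsApply f B γ m (splice f 1 P Q))
    (h0 : ∀ n : ℕ, φ ((f ^ ((n + 1) * m)) P) = 0) : shPlus f B m (splice f 1 P Q) = P := by
  have hm := h.m_pos
  have hq : ∀ k, qSeq f B m (splice f 1 P Q) k = (f ^ (k * m)) P := by
    intro k
    induction k with
    | zero => rw [qSeq, splice_of_lt (by norm_num), zpow_zero, zero_mul, pow_zero]
    | succ k ih =>
      have e : (f ^ m) ((f ^ (k * m)) P) = (f ^ ((k + 1) * m)) P := by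
        rw [← pow_add_apply, add_comm m, ← Nat.succ_mul]
      have hd := bracketsApply_splice hm hP k
      rw [ih, e] at hd
      rw [qSeq_splice_succ hm, ih, e]
      exact (hB.eq_left_iff _ _ hd).2 (Or.inl (h0 k))
  refine shPlus_eq_of_eventually (Eventually.of_forall fun k => ?_)
  rw [pSeq, hq, inv_pow_apply_pow_apply]

/-- If the cutoff is `1` on the distant past of `P`, from the step `n` on, the backward sequence is
stationary from this step on. -/
theorem IsInducing.backward_eq_pSeq (h : IsInducing f B γ c μ m L)
    (hB : IsCutoffBracket B γ φ) {v : M}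
    (hv : BracketsApply f⁻¹ (flipBracket B) γ m (splice f⁻¹ 1 v P)) {n : ℕ}
    (hn : ∀ k, n ≤ k → φ ((f⁻¹ ^ ((k + 1) * m)) P) = 1) :
    shPlus f⁻¹ (flipBracket B) m (splice f⁻¹ 1 v P)
      = pSeq f⁻¹ (flipBracket B) m (splice f⁻¹ 1 v P) n := by
  have hm := h.m_pos
  refine shPlus_eq_of_eventually ?_
  filter_upwards [eventually_ge_atTop n] with k hk
  induction k, hk using Nat.le_induction with
  | base => rfl
  | succ k hk ih =>
    rw [← ih]
    refine pSeq_succ_eq ?_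
    rw [qSeq_backward_succ hm]
    refine hB.eq_right _ _ ?_ (hn k hk)
    rw [dist_comm]
    exact bracketsApply_splice hm hv k

/-- If the cutoff does not vanish on the past of `P`, the backward limit started from `v ≠ P`
is not `P`. -/
theorem IsInducing.backward_ne (h : IsInducing f B γ c μ m L)
    (hB : IsCutoffBracket B γ φ) {v : M}
    (hv : BracketsApply f⁻¹ (flipBracket B) γ m (splice f⁻¹ 1 v P))
    (h0 : ∀ n : ℕ, φ ((f⁻¹ ^ ((n + 1) * m)) P) ≠ 0) {n : ℕ}
    (hn : ∀ k, n ≤ k → φ ((f⁻¹ ^ ((k + 1) * m)) P) = 1) (hvP : v ≠ P) :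
    shPlus f⁻¹ (flipBracket B) m (splice f⁻¹ 1 v P) ≠ P := by
  have hm := h.m_pos
  have hq : ∀ k, qSeq f⁻¹ (flipBracket B) m (splice f⁻¹ 1 v P) k ≠ (f⁻¹ ^ (k * m)) P := by
    intro k
    induction k with
    | zero =>
      rw [qSeq, splice_of_lt (by norm_num), zpow_zero, zero_mul, pow_zero]
      exact hvP
    | succ k ih =>
      rw [qSeq_backward_succ hm]
      have hd := bracketsApply_splice hm hv k
      rw [dist_comm] at hd
      intro e
      rcases (hB.eq_left_iff _ _ hd).1 e with e | e
      · exact h0 k e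
      · rw [Nat.succ_mul, add_comm, pow_add_apply] at e
        exact ih ((f⁻¹ ^ m).injective e.symm)
  rw [h.backward_eq_pSeq hB hv hn, pSeq]
  intro e
  refine hq n ((f⁻¹⁻¹ ^ (n * m)).injective ?_)
  rw [e, inv_pow_apply_pow_apply]

/-- One step along the orbits of `P` and `Q`: if the induced map selects `P` when the jump from the
orbit of `P` to that of `Q` takes place at the time `1`, it selects `P` when the jump takes place
at the time `0`. -/
theorem IsInducing.inducedMap_splice_zero_eq [CompleteSpace M] (h : IsInducing f B γ c μ m L)
    (hf : IsNorthSouth f N S) (hB : IsCutoffBracket B γ φ) (hφN : ∀ p ∈ Metric.ball N r, φ p = 1)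
    (hφS : ∀ p ∈ Metric.ball S r, φ p = 0) (hr : 0 < r) (hγr : γ < r) {X : Set (ℤ → M)}
    (happ : ∀ x ∈ X, ∀ i, AppliesAt f B γ m (shiftPow i x))
    (hinv : ∀ x ∈ X, ∀ i, inducedMap f B m (shiftPow i x) = (f ^ i) (inducedMap f B m x))
    (hPN : P ≠ N) (hPS : P ≠ S) (hQN : Q ≠ N) (hQS : Q ≠ S) (h0 : splice f 0 P Q ∈ X)
    (h1 : splice f 1 P Q ∈ X) (h1P : inducedMap f B m (splice f 1 P Q) = P) :
    inducedMap f B m (splice f 0 P Q) = P := by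
  have hm := h.m_pos
  have x0 : splice f 0 P Q 0 = Q := by
    rw [splice_of_le le_rfl, zpow_zero, Homeomorph.one_apply]
  have x1 : splice f 1 P Q 0 = P := by
    rw [splice_of_lt (by norm_num), zpow_zero, Homeomorph.one_apply]
  have b0 := h.inducedMap_eq_backward hf hB hφS hγr (happ _ h0) (hinv _ h0) hQN hQS
    (fun i hi => splice_of_lt hi) (fun i hi => splice_of_le hi.le)
  have b1 := h.inducedMap_eq_backward (P := P) hf hB hφS hγr (happ _ h1) (hinv _ h1) hQN hQS
    (fun i hi => splice_of_lt (by omega)) (fun i hi => splice_of_le (by omega))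
  have f0 := h.inducedMap_eq_forward hf hB hφN hr (happ _ h0) (hinv _ h0) hPN hPS
    (fun i hi => splice_of_lt hi) (fun i hi => splice_of_le hi.le)
  have f1 := h.inducedMap_eq_forward (Q := Q) hf hB hφN hr (happ _ h1) (hinv _ h1) hPN hPS
    (fun i hi => splice_of_lt (by omega)) (fun i hi => splice_of_le (by omega))
  rw [x0] at b0 f0
  rw [x1] at b1 f1
  rw [h.bracket.diag] at b0 f1
  by_cases hw : B P Q = P
  · rw [f0.2, hw, ← f1.2, h1P]
  · by_cases hz : ∃ n : ℕ, φ ((f⁻¹ ^ ((n + 1) * m)) P) = 0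
    · obtain ⟨n, hn⟩ := hz
      rw [b0.2, h.backward_eq_of_cutoff_zero hB b0.1 hn]
    · have hz' : ∀ n : ℕ, φ ((f⁻¹ ^ ((n + 1) * m)) P) ≠ 0 := fun n hn => hz ⟨n, hn⟩
      obtain ⟨n, hn⟩ := eventually_atTop.1
        ((hf.tendsto_north P hPN hPS).eventually (Metric.ball_mem_nhds N hr))
      exact absurd (b1.2.symm.trans h1P)
        (h.backward_ne hB b1.1 hz' (n := n) (fun k hk => hφN _ (hn _ (by nlinarith))) hw)

theorem IsInducing.not_isShiftInvariant [CompactSpace M] [ConnectedSpace M]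
    (h : IsInducing f B γ c μ m L) (hf : IsNorthSouth f N S)
    (hc : IsLocallyContracting f N S r μ) (hB : IsCutoffBracket B γ φ)
    (hφN : ∀ p ∈ Metric.ball N r, φ p = 1) (hφS : ∀ p ∈ Metric.ball S r, φ p = 0) (hγr : γ < r)
    {δ : ℝ} (hδ : ConstructionApplies f B γ m δ) : ¬ IsShiftInvariant f δ (inducedMap f B m) := by
  rintro ⟨δ', hδ'0, hδ', hsh⟩
  have hr := hc.r_pos
  have hm := h.m_pos
  have hγ := h.bracket.gamma_pos
  have hL0 : 0 < L := zero_lt_one.trans_le h.one_le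
  have : Nontrivial M := ⟨N, S, hf.ne⟩
  have hinvN : ∀ n : ℕ, ∀ x ∈ pseudoOrbits f δ',
      inducedMap f B m (shiftPow n x) = (f ^ n) (inducedMap f B m x) := by
    intro n x hx
    induction n with
    | zero =>
      have e : shiftPow ((0 : ℕ) : ℤ) x = x := by funext j; simp [shiftPow]
      rw [e, pow_zero, Homeomorph.one_apply]
    | succ n ih =>
      have e : shiftPow ((n + 1 : ℕ) : ℤ) x = shiftPow 1 (shiftPow n x) := by
        funext j
        simp only [shiftPow]
        congr 1
        push_cast
        ring
      rw [e, hsh _ (shiftPow_mem_pseudoOrbits hx _), ih, pow_succ', Homeomorph.mul_apply]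
  have hinv : ∀ x ∈ pseudoOrbits f δ', ∀ i : ℤ,
      inducedMap f B m (shiftPow i x) = (f ^ i) (inducedMap f B m x) := by
    intro x hx i
    obtain ⟨n, rfl | rfl⟩ := i.eq_nat_or_neg
    · rw [hinvN n x hx, zpow_natCast]
    · have e : shiftPow (n : ℤ) (shiftPow (-(n : ℤ)) x) = x := by
        funext j; simp [shiftPow]
      have := hinvN n _ (shiftPow_mem_pseudoOrbits hx (-(n : ℤ)))
      rw [e] at this
      rw [this, zpow_neg_natCast_apply, inv_pow_apply_pow_apply]
  have happ : ∀ x ∈ pseudoOrbits f δ', ∀ i : ℤ, AppliesAt f B γ m (shiftPow i x) :=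
    fun x hx i => hδ _ (shiftPow_mem_pseudoOrbits (pseudoOrbits_mono f hδ' hx) i)
  -- A point `p` near `N`, outside the poles, which is near `S` at the time `T`.
  obtain ⟨p, hpN, hpS, hp⟩ : ∃ p : M, p ≠ N ∧ p ≠ S ∧ p ∈ Metric.ball N r := by
    have e1 : ∀ᶠ z in 𝓝[≠] N, z ≠ S :=
      mem_nhdsWithin_of_mem_nhds (isOpen_ne.mem_nhds hf.ne)
    have e2 : ∀ᶠ z in 𝓝[≠] N, z ∈ Metric.ball N r :=
      mem_nhdsWithin_of_mem_nhds (Metric.ball_mem_nhds N hr)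
    obtain ⟨p, ⟨h1, h2⟩, h3⟩ := ((e1.and e2).and self_mem_nhdsWithin).exists
    exact ⟨p, h3, h1, h2⟩
  obtain ⟨T, hT⟩ := ((hf.tendsto_south p hpN hpS).eventually (Metric.ball_mem_nhds S hr)).exists
  -- The jump is small at all the times between `0` and `T`.
  set e := min δ' γ with he
  have he0 : 0 < e := lt_min hδ'0 hγ
  obtain ⟨q, hqp, hqN, hqS, hq⟩ : ∃ q : M, q ≠ p ∧ q ≠ N ∧ q ≠ S ∧ dist p q < e / L ^ T := by
    have e1 : ∀ᶠ z in 𝓝[≠] p, z ≠ N := mem_nhdsWithin_of_mem_nhds (isOpen_ne.mem_nhds hpN)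
    have e2 : ∀ᶠ z in 𝓝[≠] p, z ≠ S := mem_nhdsWithin_of_mem_nhds (isOpen_ne.mem_nhds hpS)
    have e3 : ∀ᶠ z in 𝓝[≠] p, z ∈ Metric.ball p (e / L ^ T) :=
      mem_nhdsWithin_of_mem_nhds (Metric.ball_mem_nhds p (by positivity))
    obtain ⟨q, ⟨⟨h1, h2⟩, h3⟩, h4⟩ := (((e1.and e2).and e3).and self_mem_nhdsWithin).exists
    exact ⟨q, h4, h1, h2, by rwa [dist_comm]⟩
  have hclose : ∀ t ≤ T, dist ((f ^ t) p) ((f ^ t) q) ≤ e := by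
    intro t ht
    refine (dist_pow_le h.lip h.one_le t p q).trans ?_
    have h1 : L ^ t ≤ L ^ T := pow_le_pow_right₀ h.one_le ht
    calc L ^ t * dist p q ≤ L ^ T * (e / L ^ T) := by gcongr
      _ = e := by field_simp
  have hne : ∀ (t : ℕ) {z w : M}, f w = w → z ≠ w → (f ^ t) z ≠ w := fun t z w hw hzw e1 =>
    hzw ((f ^ t).injective (e1.trans (pow_apply_of_fixed hw t).symm))
  have hmem : ∀ t ≤ T, splice f 0 ((f ^ t) p) ((f ^ t) q) ∈ pseudoOrbits f δ' := fun t ht =>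
    splice_mem_pseudoOrbits (by
      rw [zpow_zero]
      exact (hclose t ht).trans (min_le_left _ _))
  -- Near `S`, the induced map follows the past.
  have hend : inducedMap f B m (splice f 0 ((f ^ T) p) ((f ^ T) q)) = (f ^ T) p := by
    set P := (f ^ T) p
    set Q := (f ^ T) q
    have hφ : ∀ n : ℕ, φ ((f ^ n) P) = 0 := fun n => hφS _ (hc.pow_mem_ball hf le_rfl hT n)
    have hx := hmem T le_rfl
    have x0 : splice f 0 P Q 0 = Q := by
      rw [splice_of_le le_rfl, zpow_zero, Homeomorph.one_apply]
    have hBPQ : B P Q = P :=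
      (hB.eq_left_iff _ _ ((hclose T le_rfl).trans (min_le_right _ _))).2 (Or.inl (hφ 0))
    have f0 := h.inducedMap_eq_forward hf hB hφN hr (happ _ hx) (hinv _ hx)
      (hne T hf.fixed_north hpN) (hne T hf.fixed_south hpS)
      (fun i hi => splice_of_lt hi) (fun i hi => splice_of_le hi.le)
    rw [x0, hBPQ] at f0
    rw [f0.2, h.forward_eq_of_cutoff_zero hB f0.1 fun n => hφ _]
  have hall : ∀ t ≤ T, inducedMap f B m (splice f 0 ((f ^ t) p) ((f ^ t) q)) = (f ^ t) p := by
    intro t ht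
    induction ht using Nat.decreasingInduction with
    | self => exact hend
    | of_succ t ht ih =>
      have e1 : ∀ z, (f ^ (t + 1)) z = f ((f ^ t) z) := fun z => by
        rw [pow_succ', Homeomorph.mul_apply]
      have hx1 : splice f 1 ((f ^ t) p) ((f ^ t) q) ∈ pseudoOrbits f δ' :=
        splice_mem_pseudoOrbits (by
          rw [zpow_one, ← e1, ← e1]
          exact (hclose (t + 1) ht).trans (min_le_left _ _))
      refine h.inducedMap_splice_zero_eq hf hB hφN hφS hr hγr happ hinv (hne t hf.fixed_north hpN)
        (hne t hf.fixed_south hpS) (hne t hf.fixed_north hqN) (hne t hf.fixed_south hqS)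
        (hmem t (by omega)) hx1 (f.injective ?_)
      rw [← hsh _ hx1, shiftPow_one_splice, ← e1, ← e1, ih]
  -- Near `N`, it follows the future.
  have hstart := hall 0 (Nat.zero_le T)
  have hx := hmem 0 (Nat.zero_le T)
  rw [pow_zero, Homeomorph.one_apply, Homeomorph.one_apply] at hstart hx
  have b0 := h.inducedMap_eq_backward hf hB hφS hγr (happ _ hx) (hinv _ hx) hqN hqS
    (fun i hi => splice_of_lt hi) (fun i hi => splice_of_le hi.le)
  rw [splice_of_le le_rfl, zpow_zero, Homeomorph.one_apply, h.bracket.diag] at b0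
  rw [b0.2, h.backward_eq_pSeq hB b0.1 (n := 0) fun k _ =>
    hφN _ (hc.inv.pow_mem_ball hf.inv le_rfl hp _)] at hstart
  refine hqp ?_
  rw [← hstart, pSeq, qSeq, splice_of_lt (by norm_num)]
  simp

end ShiftInvariance

end NorthSouthShadowing

theorem proposition5p20 {d : ℕ} (hd : 1 ≤ d) {M : Type*} [MetricSpace M]
    [ChartedSpace (EuclideanSpace ℝ (Fin d)) M] [IsManifold (𝓡 d) ∞ M]
    [Bundle.RiemannianBundle (fun x : M => TangentSpace (𝓡 d) x)]
    [IsContMDiffRiemannianBundle (𝓡 d) ∞ (EuclideanSpace ℝ (Fin d))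
      (fun x : M => TangentSpace (𝓡 d) x)]
    [IsRiemannianManifold (𝓡 d) M]
    (hM : Nonempty (M ≃ₜ Metric.sphere (0 : EuclideanSpace ℝ (Fin (d + 1))) 1))
    (f : M ≃ₘ^1⟮𝓡 d, 𝓡 d⟯ M) (N S : M) (hf : IsNorthSouth f.toHomeomorph N S)
    (r μ : ℝ) (hcontr : IsLocallyContracting f.toHomeomorph N S r μ)
    (L : ℝ≥0) (hL : LipschitzWith L f) (hL' : LipschitzWith L f.symm)
    (φ : C(M, Set.Icc (0 : ℝ) 1))
    (hφN : ∀ p ∈ Metric.ball N r, (φ p : ℝ) = 1) (hφS : ∀ p ∈ Metric.ball S r, (φ p : ℝ) = 0)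
    (ρ : ℝ) (hρ : 0 < ρ) (hexp : ExpInjective M ρ) :
    (∃ (δ₀ : ℝ) (u : ℕ), IsBracketScale f.toHomeomorph N S r ρ φ δ₀ u) ∧
    ∀ (δ₀ : ℝ) (u : ℕ), IsBracketScale f.toHomeomorph N S r ρ φ δ₀ u →
      ∀ γ : ℝ, 0 < γ → γ < δ₀ → ∀ c : ℝ, c = (L : ℝ) ^ u / μ ^ u →
        IsHyperbolicBracket f.toHomeomorph (geodesicBracket ρ φ) γ c μ ∧
        ∀ m : ℕ, c * μ ^ m ≤ 1 / (2 * c) →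
          (∀ δ : ℝ, 0 < δ → 4 * L * (∑ i ∈ Finset.range m, (L : ℝ) ^ i) * δ ≤ γ →
            ConstructionApplies f.toHomeomorph (geodesicBracket ρ φ) γ m δ) ∧
          ∀ δ : ℝ, 0 < δ → ConstructionApplies f.toHomeomorph (geodesicBracket ρ φ) γ m δ →
            (∀ x ∈ pseudoOrbits f.toHomeomorph δ,
              Filter.Tendsto (pSeq f.toHomeomorph (geodesicBracket ρ φ) m x) Filter.atTop
                (𝓝 (shPlus f.toHomeomorph (geodesicBracket ρ φ) m x)) ∧
              Filter.Tendsto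
                (pSeq f.toHomeomorph⁻¹ (flipBracket (geodesicBracket ρ φ)) m (reverseSeq x))
                Filter.atTop (𝓝 (shMinus f.toHomeomorph (geodesicBracket ρ φ) m x))) ∧
            IsShadowingMap f.toHomeomorph δ
              (inducedMap f.toHomeomorph (geodesicBracket ρ φ) m) ∧
            (∀ lam : ℝ, 0 < lam → lam < 1 → HasSelfTuning lam f.toHomeomorph δ
              (inducedMap f.toHomeomorph (geodesicBracket ρ φ) m)) ∧
            ¬ IsShiftInvariant f.toHomeomorph δ
              (inducedMap f.toHomeomorph (geodesicBracket ρ φ) m) := by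
  have hM0 := hM.some
  have : CompactSpace M := hM0.symm.compactSpace
  have : ConnectedSpace M := by
    have hs : ConnectedSpace (Metric.sphere (0 : EuclideanSpace ℝ (Fin (d + 1))) 1) := by
      refine Subtype.connectedSpace (isConnected_sphere ?_ 0 zero_le_one)
      rw [← Module.finrank_eq_rank, finrank_euclideanSpace_fin]
      exact_mod_cast Nat.lt_succ_of_le hd
    exact hM0.symm.surjective.connectedSpace hM0.symm.continuous
  have hMg : HasAlmostGeodesics M := hasAlmostGeodesics_of_isRiemannianManifold (𝓡 d)
  set g : M ≃ₜ M := f.toHomeomorph with hg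
  have hlip : ∀ p q, dist (g p) (g q) ≤ L * dist p q := fun p q => hL.dist_le_mul p q
  have hlip' : ∀ p q, dist (g⁻¹ p) (g⁻¹ q) ≤ L * dist p q := fun p q => hL'.dist_le_mul p q
  have hL1 : (1 : ℝ) ≤ L := by
    have h1 : 0 < dist N S := dist_pos.2 hf.ne
    have h2 := hlip N S
    rw [hf.fixed_north, hf.fixed_south] at h2
    exact le_of_mul_le_mul_right (by linarith) h1
  refine ⟨exists_isBracketScale hMg hf hcontr φ hρ hexp, ?_⟩
  rintro δ₀ u hs γ hγ0 hγ c rfl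
  have hB := isHyperbolicBracket_geodesicBracket hMg hf hcontr hlip hlip' hL1 hφN hφS hexp
    hs hγ0 hγ
  refine ⟨hB, fun m hm => ?_⟩
  have h : IsInducing g (geodesicBracket ρ φ) γ ((L : ℝ) ^ u / μ ^ u) μ m L :=
    ⟨hB, hlip, hlip', hL1, hm⟩
  have hγρ : γ ≤ ρ := (hγ.trans hs.delta_lt_rho).le
  refine ⟨fun δ hδ hδγ => h.constructionApplies hδ hδγ, fun δ hδ happ => ⟨fun x hx =>
    ⟨h.tendsto_pSeq (happ x hx).1, h.flip.tendsto_pSeq (happ x hx).2.1⟩,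
    h.isShadowingMap hδ happ, fun lam h0 h1 => h.hasSelfTuning happ h0 h1, ?_⟩⟩
  exact h.not_isShiftInvariant (φ := fun p => (φ p : ℝ)) hf hcontr
    ⟨fun p q hpq hp => geodesicBracket_eq_right hMg hexp φ (hpq.trans hγρ) hp,
      fun p q hpq => geodesicBracket_eq_left_iff hMg hexp φ (hpq.trans hγρ)⟩
    hφN hφS (hγ.trans hs.delta_lt_r) happ
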